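/- Let $L\subset\mathbb C$ be a lattice of rank $2$ and let $\mathcal O_L=\{m\in\mathbb C : mL\subset L\}$ be its ring of multipliers. For $k\in\{1,2\}$ and $z\in\mathbb C$ let $$E_k(z)=\sum_{l\in L,\ l+z\neq 0}(l+z)^{-k}\,|l+z|^{-s}\Big|_{s=0},$$ where the value at $s=0$ is that of the analytic continuation in $s$ of the series, which converges for $\operatorname{Re}s>2-k$. For $h,k\in\mathcal O_L$ with $k\neq 0$ let $$D_L(h,k)=\frac1k\sum_{\mu\in L/kL}E_1\Big(\frac{h\mu}{k}\Big)E_1\Big(\frac{\mu}{k}\Big),$$ and put $I(z)=z-\overline z$. Let $A_i=\begin{pmatrix}a_i&b_i\\c_i&d_i\end{pmatrix}\in SL_2(\mathcal O_L)$ for $i\in\{1,2,3\}$, with $A_1=A_2A_3$. Suppose that $c_1=c_2=c\neq 0$, that $a_1a_2\equiv 1\pmod{c\,\mathcal O_L}$, and that $c_3\neq 0$. Then the continuations that define $E_1(z)$ (for every $z\in\mathbb C$) and $E_2(0)$ exist, and $$D_L(a_3,c_3)=E_2(0)\,I\Big(\frac{2}{c_3}+\frac{c_3}{c^2}\Big).$$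 -/

import Mathlib

noncomputable section

namespace EllipticDedekind

/-- The ring of multipliers `{m ∈ ℂ : m L ⊆ L}`. -/
def multiplierRing (L : Submodule ℤ ℂ) : Subring ℂ where
  carrier := {m | ∀ l ∈ L, m * l ∈ L}
  mul_mem' := by
    intro a b ha hb l hl
    rw [mul_assoc]
    exact ha _ (hb l hl)
  one_mem' := by
    intro l hl
    simpa using hl
  add_mem' := by
    intro a b ha hb l hl
    rw [add_mul]
    exact L.add_mem (ha l hl) (hb l hl)
  zero_mem' := by
    intro l _
    simp
  neg_mem' := by
    intro a ha l hl
    rw [neg_mul]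
    exact L.neg_mem (ha l hl)

/-- The summand `w⁻ᵏ |w|⁻ˢ`, with the term at `w = 0` left out. -/
def eisTerm (k : ℕ) (s w : ℂ) : ℂ :=
  if w = 0 then 0 else (w ^ k)⁻¹ * ((‖w‖ : ℝ) : ℂ) ^ (-s)

/-- For `k ≥ 1`: `v` is the value at `s = 0` of the analytic continuation of
`s ↦ ∑_{l ∈ L, l + z ≠ 0} (l + z)⁻ᵏ |l + z|⁻ˢ`, a series that converges absolutely for
`Re s > 2 - k`. The continuation is taken along some half-plane `Re s > -ε`; a half-plane is
connected, so the value does not depend on the choices (`IsEisValue.unique`). -/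
def IsEisValue (L : Submodule ℤ ℂ) (k : ℕ) (z v : ℂ) : Prop :=
  ∃ ε : ℝ, 0 < ε ∧ ∃ F : ℂ → ℂ,
    DifferentiableOn ℂ F {s : ℂ | -ε < s.re} ∧
    (∀ s : ℂ, 2 - (k : ℝ) < s.re → HasSum (fun l : L => eisTerm k s ((l : ℂ) + z)) (F s)) ∧
    F 0 = v

theorem IsEisValue.unique {L : Submodule ℤ ℂ} {k : ℕ} {z v w : ℂ}
    (hv : IsEisValue L k z v) (hw : IsEisValue L k z w) : v = w := by
  obtain ⟨ε, hε, F, hF, hFs, rfl⟩ := hv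
  obtain ⟨δ, hδ, G, hG, hGs, rfl⟩ := hw
  have hopen : ∀ r : ℝ, IsOpen {s : ℂ | r < s.re} := fun r =>
    isOpen_lt continuous_const Complex.continuous_re
  have hη : 0 < min ε δ := lt_min hε hδ
  have hF' : AnalyticOnNhd ℂ F {s : ℂ | -(min ε δ) < s.re} :=
    (hF.mono fun s (hs : -(min ε δ) < s.re) =>
      lt_of_le_of_lt (neg_le_neg (min_le_left _ _)) hs).analyticOnNhd (hopen _)
  have hG' : AnalyticOnNhd ℂ G {s : ℂ | -(min ε δ) < s.re} :=
    (hG.mono fun s (hs : -(min ε δ) < s.re) =>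
      lt_of_le_of_lt (neg_le_neg (min_le_right _ _)) hs).analyticOnNhd (hopen _)
  have hk : (0 : ℝ) ≤ k := Nat.cast_nonneg k
  refine hF'.eqOn_of_preconnected_of_eventuallyEq (z₀ := 3) hG'
    (convex_halfSpace_re_gt _).isPreconnected ?_ ?_ ?_
  · show -(min ε δ) < (3 : ℂ).re
    norm_num
    linarith
  · have h3 : (3 : ℂ) ∈ {s : ℂ | 2 - (k : ℝ) < s.re} := by
      show 2 - (k : ℝ) < (3 : ℂ).re
      norm_num
      linarith
    filter_upwards [(hopen _).mem_nhds h3] with s hs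
    exact (hFs s hs).unique (hGs s hs)
  · show -(min ε δ) < (0 : ℂ).re
    simpa using hη

/-- `E_k(z)` for the lattice `L` and `k ≥ 1`: the number `v` with `IsEisValue L k z v`. -/
def E (L : Submodule ℤ ℂ) (k : ℕ) (z : ℂ) : ℂ :=
  Classical.epsilon (IsEisValue L k z)

theorem isEisValue_add_iff (L : Submodule ℤ ℂ) (k : ℕ) (z v : ℂ) {m : ℂ} (hm : m ∈ L) :
    IsEisValue L k (z + m) v ↔ IsEisValue L k z v := by
  have key : ∀ s a : ℂ, HasSum (fun l : L => eisTerm k s ((l : ℂ) + (z + m))) a ↔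
      HasSum (fun l : L => eisTerm k s ((l : ℂ) + z)) a := by
    intro s a
    have : ((fun l : L => eisTerm k s ((l : ℂ) + z)) ∘ Equiv.addRight (⟨m, hm⟩ : L)) =
        fun l : L => eisTerm k s ((l : ℂ) + (z + m)) := by
      funext l
      simp [add_assoc, add_comm m z]
    rw [← this]
    exact Equiv.hasSum_iff _
  simp only [IsEisValue, key]

theorem E_add_of_mem (L : Submodule ℤ ℂ) (k : ℕ) (z : ℂ) {m : ℂ} (hm : m ∈ L) :
    E L k (z + m) = E L k z := by
  have h : IsEisValue L k (z + m) = IsEisValue L k z := by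
    funext v
    exact propext (isEisValue_add_iff L k z v hm)
  rw [E, E, h]

/-- Multiplication by an element of the ring of multipliers, as an endomorphism of `L`. -/
def mulEnd (L : Submodule ℤ ℂ) (k : multiplierRing L) : L →ₗ[ℤ] L where
  toFun l := ⟨(k : ℂ) * l, k.2 l l.2⟩
  map_add' x y := Subtype.ext (mul_add _ _ _)
  map_smul' n x := Subtype.ext (by simp; ring)

/-- The sublattice `k L` of `L`. -/
def scaled (L : Submodule ℤ ℂ) (k : multiplierRing L) : Submodule ℤ L :=
  LinearMap.range (mulEnd L k)

/-- The summand `μ ↦ E_1(h μ / k) E_1(μ / k)` as a function on `L / k L`. -/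
def dedekindTerm (L : Submodule ℤ ℂ) (h k : multiplierRing L) (hk : k ≠ 0) :
    L ⧸ scaled L k → ℂ :=
  fun q => Quotient.liftOn' q
    (fun μ : L => E L 1 ((h : ℂ) * μ / k) * E L 1 ((μ : ℂ) / k)) <| by
      intro μ ν hμν
      have hk' : (k : ℂ) ≠ 0 := fun h0 => hk (Subtype.ext h0)
      obtain ⟨l, hl⟩ := (Submodule.quotientRel_def _).1 hμν
      have hl' : (k : ℂ) * l = (μ : ℂ) - ν := congrArg Subtype.val hl
      have hμ : (μ : ℂ) = ν + k * l := by rw [hl']; ring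
      have h1 : (μ : ℂ) / k = (ν : ℂ) / k + l := by rw [hμ]; field_simp
      have h2 : (h : ℂ) * μ / k = (h : ℂ) * ν / k + h * l := by rw [hμ]; field_simp
      show E L 1 ((h : ℂ) * μ / k) * E L 1 ((μ : ℂ) / k) =
        E L 1 ((h : ℂ) * ν / k) * E L 1 ((ν : ℂ) / k)
      rw [h1, h2, E_add_of_mem L 1 _ l.2, E_add_of_mem L 1 _ (h.2 l l.2)]

/-- The quotient `L / k L` is finite, so that the sum below is a finite sum. -/
theorem finite_quotient_scaled (L : Submodule ℤ ℂ) [DiscreteTopology L] [IsZLattice ℝ L]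
    (k : multiplierRing L) (hk : k ≠ 0) : Finite (L ⧸ scaled L k) := by
  have hk' : (k : ℂ) ≠ 0 := fun h0 => hk (Subtype.ext h0)
  have : Module.Finite ℤ L := ZLattice.module_finite ℝ L
  have : Module.Free ℤ L := ZLattice.module_free ℝ L
  refine Submodule.finiteQuotientOfFreeOfRankEq (scaled L k) ?_
  refine LinearMap.finrank_range_of_inj ?_
  intro x y hxy
  exact Subtype.ext (mul_left_cancel₀ hk' (congrArg Subtype.val hxy))

/-- The elliptic Dedekind sum `D_L(h, k)`, for `k ≠ 0`. -/
def D (L : Submodule ℤ ℂ) (h k : multiplierRing L) (hk : k ≠ 0) : ℂ :=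
  1 / (k : ℂ) * ∑ᶠ q : L ⧸ scaled L k, dedekindTerm L h k hk q

/-- `I(z) = z - z̄`. -/
def I (z : ℂ) : ℂ := z - (starRingEnd ℂ) z

end EllipticDedekind

end

namespace EllipticDedekind

open Filter Topology
open scoped ComplexConjugate

/-! ### Series of holomorphic functions with locally eventual bounds -/

/-! Put `n = a₂ - a₁`. Comparing entries in `A₁ = A₂ A₃` gives `c₃ = c n` and `a₃ = 1 - d₂ n`, so
the Dedekind sum is `1 / (c n)` times the sum of `E_1((1 - d₂ n) x) E_1(x)` over the `c n`-torsion
points `x` of `ℂ / L`. Three facts evaluate it.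

Addition theorem (`E_one_addition`, `torus_addition`): away from poles, `(E_1(u) + E_1(v) - E_1(u +
v))² = ℘(u) + ℘(v) + ℘(u + v)`. It is applied with `u = (1 - d₂ n) x` and `v = d₂ n x`, so that `u +
v = x` and one of the cross terms is the wanted product.

Distribution relations (`sum_E_distribution`): summing `E_1` along the fibres of `x ↦ n x` moves the
other two cross terms to the `c`-torsion. There `1 - d₂ n ≡ d₂² (mod c)`, which follows from `a₁ a₂
≡ 1`, makes them equal, and they enter with opposite signs (`sum_dedekind`). The relation for `E_2`
also gives the sum of `℘` over `k`-torsion as `k (k - k̄) E_2(0)`.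

Sums of squares (`card_mul_sum_torusE_sq`): summing the addition theorem over all pairs of
`k`-torsion points expresses the sum of `E_1²` by that of `℘`.

The continuation in `s` needs no Poisson summation. Subtracting a second order Taylor polynomial
from the series for `E_1(z, s)` leaves a series converging for `Re s > -1`; the two unknown
coefficients multiply `z` and `z̄`, and they are determined because `E_1(m, s) = 0` at two
independent lattice points `m` (`exists_coefficients`). At `s = 0` this yields `E_1(z) = ζ(z) - α z
- κ z̄`. -/

/-- This is the Weierstrass M-test after splitting off the finitely many terms that violate the
bound. That finite set may depend on the neighbourhood, as it must for lattice series whose terms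
near `l = 0` are not controlled. -/
theorem series_of_eventual_bound {ι : Type*} {F : ι → ℂ → ℂ} {U : Set ℂ} (hU : IsOpen U)
    (hF : ∀ i, DifferentiableOn ℂ (F i) U)
    (hb : ∀ x ∈ U, ∃ V ∈ 𝓝 x, ∃ u : ι → ℝ, Summable u ∧
      ∀ᶠ i in cofinite, ∀ y ∈ V, ‖F i y‖ ≤ u i) {x : ℂ} (hx : x ∈ U) :
    Summable (fun i => F i x) ∧ DifferentiableAt ℂ (fun y => ∑' i, F i y) x ∧
      HasSum (fun i => deriv (F i) x) (deriv (fun y => ∑' i, F i y) x) := by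
  classical
  obtain ⟨V, hV, u, hu, hle⟩ := hb x hx
  obtain ⟨W, hWsub, hWo, hxW⟩ := mem_nhds_iff.1 (inter_mem hV (hU.mem_nhds hx))
  rw [eventually_cofinite] at hle
  set S : Finset ι := hle.toFinset with hS
  have hSle : ∀ i ∉ S, ∀ y ∈ W, ‖F i y‖ ≤ u i := by
    intro i hi y hy
    have : ∀ y ∈ V, ‖F i y‖ ≤ u i := by simpa [hS] using hi
    exact this y (hWsub hy).1
  let G : ι → ℂ → ℂ := fun i y => if i ∈ S then 0 else F i y
  let v : ι → ℝ := fun i => if i ∈ S then 0 else u i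
  have hv : Summable v := by
    refine (summable_congr_cofinite ?_).1 hu
    rw [EventuallyEq, eventually_cofinite]
    refine S.finite_toSet.subset fun i hi => ?_
    by_contra h
    exact hi (by simp only [v]; rw [if_neg (by simpa using h)])
  have hGd : ∀ i, DifferentiableOn ℂ (G i) W := by
    intro i
    by_cases hi : i ∈ S
    · simp only [G, hi, if_true]; exact differentiableOn_const _
    · simp only [G, hi, if_false]; exact (hF i).mono fun y hy => (hWsub hy).2
  have hGle : ∀ i, ∀ y ∈ W, ‖G i y‖ ≤ v i := by
    intro i y hy
    by_cases hi : i ∈ S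
    · simp [G, v, hi]
    · simpa [G, v, hi] using hSle i hi y hy
  have hGs : ∀ y ∈ W, Summable fun i => G i y := fun y hy =>
    Summable.of_norm_bounded hv fun i => hGle i y hy
  let K : ι → ℂ → ℂ := fun i y => if i ∈ S then F i y else 0
  have hK : ∀ y, HasSum (fun i => K i y) (∑ i ∈ S, F i y) := by
    intro y
    have : HasSum (fun i => K i y) (∑ i ∈ S, K i y) :=
      hasSum_sum_of_ne_finset_zero fun i hi => by simp [K, hi]
    rwa [Finset.sum_congr rfl (fun i hi => by simp [K, hi] : ∀ i ∈ S, K i y = F i y)] at this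
  have hsplit : ∀ i y, F i y = K i y + G i y := by
    intro i y; by_cases hi : i ∈ S <;> simp [K, G, hi]
  have hsum : ∀ y ∈ W, HasSum (fun i => F i y) (∑ i ∈ S, F i y + ∑' i, G i y) := by
    intro y hy
    simp only [fun i => hsplit i y]
    rw [Finset.sum_congr rfl (fun i hi => by simp [K, G, hi] :
      ∀ i ∈ S, K i y + G i y = F i y)]
    exact (hK y).add (hGs y hy).hasSum
  have heq : (fun y => ∑' i, F i y) =ᶠ[𝓝 x] fun y => ∑ i ∈ S, F i y + ∑' i, G i y := by
    filter_upwards [hWo.mem_nhds hxW] with y hy using (hsum y hy).tsum_eq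
  have hFx : ∀ i, DifferentiableAt ℂ (F i) x := fun i => (hF i).differentiableAt (hU.mem_nhds hx)
  have hGt : DifferentiableAt ℂ (fun y => ∑' i, G i y) x :=
    (Complex.differentiableOn_tsum_of_summable_norm hv hGd hWo hGle).differentiableAt
      (hWo.mem_nhds hxW)
  have hSd : DifferentiableAt ℂ (fun y => ∑ i ∈ S, F i y) x :=
    DifferentiableAt.fun_sum fun i _ => hFx i
  refine ⟨(hsum x hxW).summable, heq.differentiableAt_iff.2 (hSd.add hGt), ?_⟩
  rw [heq.deriv_eq, deriv_fun_add hSd hGt, deriv_fun_sum fun i _ => hFx i]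
  have h1 : HasSum (fun i => if i ∈ S then deriv (F i) x else 0) (∑ i ∈ S, deriv (F i) x) := by
    have : HasSum (fun i => if i ∈ S then deriv (F i) x else 0)
        (∑ i ∈ S, if i ∈ S then deriv (F i) x else 0) :=
      hasSum_sum_of_ne_finset_zero fun i hi => by simp [hi]
    rwa [Finset.sum_congr rfl (fun i hi => by simp [hi] :
      ∀ i ∈ S, (if i ∈ S then deriv (F i) x else 0) = deriv (F i) x)] at this
  have h2 := Complex.hasSum_deriv_of_summable_norm hv hGd hWo hGle hxW
  refine (h1.add h2).congr_fun ?_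
  intro i
  by_cases hi : i ∈ S <;> simp [G, hi]

/-! ### The summands -/

theorem eisTerm_zero (k : ℕ) (s : ℂ) : eisTerm k s 0 = 0 := by simp [eisTerm]

theorem eisTerm_of_ne {k : ℕ} {s w : ℂ} (hw : w ≠ 0) :
    eisTerm k s w = (w ^ k)⁻¹ * ((‖w‖ : ℝ) : ℂ) ^ (-s) := by simp [eisTerm, hw]

theorem eisTerm_exponent_zero {k : ℕ} (hk : k ≠ 0) (w : ℂ) : eisTerm k 0 w = (w ^ k)⁻¹ := by
  by_cases hw : w = 0 <;> simp [eisTerm, hw, hk]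

theorem differentiable_eisTerm (k : ℕ) (w : ℂ) : Differentiable ℂ fun s => eisTerm k s w := by
  by_cases hw : w = 0
  · simp [eisTerm, hw]
  · simp only [eisTerm_of_ne hw]
    intro s
    have : ((‖w‖ : ℝ) : ℂ) ≠ 0 := by simpa using hw
    exact ((differentiableAt_id.neg).const_cpow (Or.inl this)).const_mul _

theorem norm_eisTerm {k : ℕ} {s w : ℂ} (hw : w ≠ 0) :
    ‖eisTerm k s w‖ = ‖w‖ ^ (-(k : ℝ) - s.re) := by
  have h := norm_pos_iff.2 hw
  rw [eisTerm_of_ne hw, norm_mul, norm_inv, norm_pow, Complex.norm_cpow_eq_rpow_re_of_pos h,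
    sub_eq_add_neg, Real.rpow_add h, Real.rpow_neg h.le, Real.rpow_natCast, Complex.neg_re]

theorem norm_eisTerm_le {k : ℕ} {s w : ℂ} {σ : ℝ} (hw : 1 ≤ ‖w‖) (hσ : σ ≤ s.re) :
    ‖eisTerm k s w‖ ≤ ‖w‖ ^ (-(k : ℝ) - σ) := by
  rw [norm_eisTerm (norm_pos_iff.1 (by linarith))]
  exact Real.rpow_le_rpow_of_exponent_le hw (by linarith)

theorem eisTerm_mul {k : ℕ} {s : ℂ} (a w : ℂ) (ha : a ≠ 0) :
    eisTerm k s (a * w) = eisTerm k s a * eisTerm k s w := by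
  by_cases hw : w = 0
  · simp [hw, eisTerm_zero]
  rw [eisTerm_of_ne (mul_ne_zero ha hw), eisTerm_of_ne ha, eisTerm_of_ne hw, norm_mul,
    Complex.ofReal_mul, Complex.mul_cpow_ofReal_nonneg (norm_nonneg _) (norm_nonneg _), mul_pow,
    mul_inv]
  ring

theorem eisTerm_neg (k : ℕ) (s w : ℂ) : eisTerm k s (-w) = (-1) ^ k * eisTerm k s w := by
  rw [← neg_one_mul, eisTerm_mul _ _ (by norm_num), eisTerm_of_ne (w := -1) (by norm_num)]
  simp [← inv_pow]

theorem eisTerm_one_div (s w : ℂ) : eisTerm 1 s w / w = eisTerm 2 s w := by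
  by_cases hw : w = 0
  · simp [hw, eisTerm_zero]
  · rw [eisTerm_of_ne hw, eisTerm_of_ne hw]; field_simp

/-- Factor `l + z = l (1 + z / l)` and write `|w|⁻ˢ = exp(-s Re log w)` with `2 Re log w` the sum of
`log w` and its conjugate. -/
theorem eisTerm_add {k : ℕ} {s l z : ℂ} (hl : l ≠ 0) (hz : ‖z / l‖ < 1) :
    eisTerm k s (l + z) = eisTerm k s l * Complex.exp (-(k + s / 2) * Complex.log (1 + z / l) +
      -(s / 2) * conj (Complex.log (1 + z / l))) := by
  have h1 : 1 + z / l ≠ 0 := by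
    intro h
    have : z / l = -1 := by linear_combination h
    rw [this] at hz
    norm_num at hz
  have : l + z = l * (1 + z / l) := by field_simp
  rw [this, eisTerm_mul _ _ hl, eisTerm_of_ne h1]
  congr 1
  have hn : ((‖1 + z / l‖ : ℝ) : ℂ) ≠ 0 := by simpa using h1
  rw [Complex.cpow_def_of_ne_zero hn, ← Complex.ofReal_log (norm_nonneg _), ← Complex.log_re]
  have h2 : ((1 + z / l) ^ k)⁻¹ = Complex.exp (-k * Complex.log (1 + z / l)) := by
    rw [neg_mul, Complex.exp_neg, Complex.exp_nat_mul, Complex.exp_log h1]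
  rw [h2, ← Complex.exp_add]
  congr 1
  have := Complex.add_conj (Complex.log (1 + z / l))
  push_cast at this
  linear_combination (s / 2) * this

/-- The constant is `11 = 9 + 2`: the exponent has norm at most `3 M ‖q‖`, whose square bounds the
error of `exp`, and replacing `log (1 + q)` by `q` costs at most `2 M ‖q‖²`. -/
theorem norm_exp_log_taylor {M : ℝ} (hM : 1 ≤ M) {α β q : ℂ} (hα : ‖α‖ ≤ M) (hβ : ‖β‖ ≤ M)
    (hq : 6 * M * ‖q‖ ≤ 1) :
    ‖Complex.exp (α * Complex.log (1 + q) + β * conj (Complex.log (1 + q))) - 1 -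
      (α * q + β * conj q)‖ ≤ 11 * M ^ 2 * ‖q‖ ^ 2 := by
  have hq0 := norm_nonneg q
  have hq2 : ‖q‖ ≤ 1 / 6 := by nlinarith
  set Λ := Complex.log (1 + q) with hΛ
  have h1 : ‖Λ - q‖ ≤ ‖q‖ ^ 2 := by
    refine (Complex.norm_log_one_add_sub_self_le (by linarith)).trans ?_
    have : (1 - ‖q‖)⁻¹ ≤ 2 := by
      rw [inv_le_comm₀ (by linarith) (by norm_num)]; linarith
    nlinarith [sq_nonneg ‖q‖]
  have h2 : ‖Λ‖ ≤ 3 / 2 * ‖q‖ := by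
    calc ‖Λ‖ = ‖(Λ - q) + q‖ := by ring_nf
      _ ≤ ‖Λ - q‖ + ‖q‖ := norm_add_le _ _
      _ ≤ _ := by nlinarith
  have hx : ‖α * Λ + β * conj Λ‖ ≤ 3 * M * ‖q‖ := by
    calc ‖α * Λ + β * conj Λ‖ ≤ ‖α * Λ‖ + ‖β * conj Λ‖ := norm_add_le _ _
      _ = ‖α‖ * ‖Λ‖ + ‖β‖ * ‖Λ‖ := by simp
      _ ≤ M * (3 / 2 * ‖q‖) + M * (3 / 2 * ‖q‖) := by gcongr
      _ = _ := by ring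
  have h3 := Complex.norm_exp_sub_one_sub_id_le (x := α * Λ + β * conj Λ) (by linarith [hx])
  have h4 : ‖α * (Λ - q) + β * conj (Λ - q)‖ ≤ 2 * M * ‖q‖ ^ 2 := by
    calc _ ≤ ‖α * (Λ - q)‖ + ‖β * conj (Λ - q)‖ := norm_add_le _ _
      _ = ‖α‖ * ‖Λ - q‖ + ‖β‖ * ‖Λ - q‖ := by simp only [norm_mul, RCLike.norm_conj]
      _ ≤ M * ‖q‖ ^ 2 + M * ‖q‖ ^ 2 := by gcongr
      _ = _ := by ring
  have h5 : ‖α * Λ + β * conj Λ‖ ^ 2 ≤ (3 * M * ‖q‖) ^ 2 := by gcongr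
  calc _ = ‖(Complex.exp (α * Λ + β * conj Λ) - 1 - (α * Λ + β * conj Λ)) +
        (α * (Λ - q) + β * conj (Λ - q))‖ := by
        congr 1; rw [map_sub]; ring
    _ ≤ _ := norm_add_le _ _
    _ ≤ (3 * M * ‖q‖) ^ 2 + 2 * M * ‖q‖ ^ 2 := by linarith
    _ ≤ _ := by nlinarith [sq_nonneg ‖q‖, mul_nonneg (by linarith : (0:ℝ) ≤ M) (sq_nonneg ‖q‖)]

/-- The second order Taylor remainder of `z ↦ eisTerm k s (l + z)` at `z = 0`. -/
noncomputable def taylorTerm (k : ℕ) (s z l : ℂ) : ℂ :=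
  eisTerm k s (l + z) - eisTerm k s l + (k + s / 2) * (z * (eisTerm k s l / l)) +
    s / 2 * (conj z * (eisTerm k s l / conj l))

theorem norm_taylorTerm_le {k : ℕ} {M σ R : ℝ} {s z l : ℂ} (hM : 1 ≤ M) (hk : k + M ≤ 2 * M)
    (hs : ‖s‖ ≤ M) (hσ : σ ≤ s.re) (hz : ‖z‖ ≤ R) (hl : 1 ≤ ‖l‖) (hl' : 12 * M * R ≤ ‖l‖) :
    ‖taylorTerm k s z l‖ ≤ 44 * M ^ 2 * R ^ 2 * ‖l‖ ^ (-(k : ℝ) - σ - 2) := by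
  have hl0 : 0 < ‖l‖ := by linarith
  have hl1 : l ≠ 0 := norm_pos_iff.1 hl0
  have hR : 0 ≤ R := (norm_nonneg _).trans hz
  have hq : ‖z / l‖ ≤ R / ‖l‖ := by rw [norm_div]; gcongr
  have hq' : 6 * (2 * M) * ‖z / l‖ ≤ 1 := by
    calc 6 * (2 * M) * ‖z / l‖ ≤ 6 * (2 * M) * (R / ‖l‖) := by gcongr
      _ = 12 * M * R / ‖l‖ := by ring
      _ ≤ 1 := (div_le_one hl0).2 hl'
  have hq1 : ‖z / l‖ < 1 := by nlinarith [norm_nonneg (z / l)]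
  have hs2 : ‖s / 2‖ ≤ M := by
    rw [norm_div]; norm_num; linarith [norm_nonneg s]
  have hα : ‖-((k : ℂ) + s / 2)‖ ≤ 2 * M := by
    rw [norm_neg]
    refine (norm_add_le _ _).trans ?_
    simp only [Complex.norm_natCast]
    linarith
  have hβ : ‖-(s / 2)‖ ≤ 2 * M := by rw [norm_neg]; linarith
  -- The exponents are bounded by `2 * M`, hence `44 = 11 * 2 ^ 2` and the threshold `12 * M * R`.
  have key := norm_exp_log_taylor (by linarith) hα hβ hq'
  have e : taylorTerm k s z l = eisTerm k s l * (Complex.exp (-(k + s / 2) *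
      Complex.log (1 + z / l) + -(s / 2) * conj (Complex.log (1 + z / l))) - 1 -
      (-(k + s / 2) * (z / l) + -(s / 2) * conj (z / l))) := by
    rw [taylorTerm, eisTerm_add hl1 hq1, map_div₀]; ring
  rw [e, norm_mul]
  calc _ ≤ ‖l‖ ^ (-(k : ℝ) - σ) * (11 * (2 * M) ^ 2 * (R / ‖l‖) ^ 2) := by
        refine mul_le_mul (norm_eisTerm_le hl hσ) (key.trans ?_) (norm_nonneg _) (by positivity)
        gcongr
    _ = _ := by
        rw [Real.rpow_sub hl0 _ 2]
        norm_num
        ring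

theorem norm_eisTerm_add_sub_le {k : ℕ} {M σ R : ℝ} {s z l : ℂ} (hM : 1 ≤ M)
    (hk : k + M ≤ 2 * M)
    (hs : ‖s‖ ≤ M) (hσ : σ ≤ s.re) (hz : ‖z‖ ≤ R) (hl : 1 ≤ ‖l‖) (hl' : 12 * M * R ≤ ‖l‖) :
    ‖eisTerm k s (l + z) - eisTerm k s l‖ ≤ 7 * M * R * ‖l‖ ^ (-(k : ℝ) - σ - 1) := by
  have hl0 : 0 < ‖l‖ := by linarith
  have hR : 0 ≤ R := (norm_nonneg _).trans hz
  have h1 := norm_taylorTerm_le hM hk hs hσ hz hl hl'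
  have h2 := norm_eisTerm_le (k := k) hl hσ
  have hs2 : ‖s / 2‖ ≤ M / 2 := by
    rw [norm_div]; norm_num; linarith [norm_nonneg s]
  have hα : ‖(k : ℂ) + s / 2‖ ≤ 2 * M := by
    refine (norm_add_le _ _).trans ?_
    simp only [Complex.norm_natCast]
    linarith
  have e : eisTerm k s (l + z) - eisTerm k s l = taylorTerm k s z l -
      ((k + s / 2) * (z * (eisTerm k s l / l)) + s / 2 * (conj z * (eisTerm k s l / conj l))) := by
    rw [taylorTerm]; ring
  have e1 : ‖l‖ ^ (-(k : ℝ) - σ - 1) = ‖l‖ ^ (-(k : ℝ) - σ) / ‖l‖ := by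
    rw [Real.rpow_sub hl0, Real.rpow_one]
  have e2 : ‖l‖ ^ (-(k : ℝ) - σ - 2) = ‖l‖ ^ (-(k : ℝ) - σ) / ‖l‖ ^ 2 := by
    rw [Real.rpow_sub hl0]; norm_num
  rw [e2] at h1
  rw [e, e1]
  set X := ‖l‖ ^ (-(k : ℝ) - σ) with hX
  have hX0 : 0 ≤ X := by positivity
  calc _ ≤ ‖taylorTerm k s z l‖ + (‖((k + s / 2) * (z * (eisTerm k s l / l)))‖ +
        ‖s / 2 * (conj z * (eisTerm k s l / conj l))‖) :=
        (norm_sub_le _ _).trans (by gcongr; exact norm_add_le _ _)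
    _ = ‖taylorTerm k s z l‖ + (‖(k : ℂ) + s / 2‖ * (‖z‖ * (‖eisTerm k s l‖ / ‖l‖)) +
        ‖s / 2‖ * (‖z‖ * (‖eisTerm k s l‖ / ‖l‖))) := by
        simp only [norm_mul, norm_div, RCLike.norm_conj]
    _ ≤ 44 * M ^ 2 * R ^ 2 * (X / ‖l‖ ^ 2) + (2 * M * (R * (X / ‖l‖)) +
        M / 2 * (R * (X / ‖l‖))) := by gcongr
    _ = (X / ‖l‖) * M * R * (44 * (M * R / ‖l‖) + 5 / 2) := by field_simp; ring
    _ ≤ (X / ‖l‖) * M * R * 7 := by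
        gcongr
        have : M * R / ‖l‖ ≤ 1 / 12 := by rw [div_le_iff₀ hl0]; linarith
        linarith
    _ = _ := by ring

/-! ### Lattice series -/

section Lattice

variable (L : Submodule ℤ ℂ) [DiscreteTopology L] [IsZLattice ℝ L]

theorem summable_norm_rpow_neg {r : ℝ} (hr : 2 < r) : Summable fun l : L => ‖(l : ℂ)‖ ^ (-r) := by
  have h := ZLattice.summable_norm_rpow L (-r) (by
    rw [ZLattice.rank ℝ L, Complex.finrank_real_complex]; push_cast; linarith)
  simpa using h

omit [IsZLattice ℝ L] in
theorem isClosed_lattice : IsClosed (L : Set ℂ) :=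
  @AddSubgroup.isClosed_of_discrete _ _ _ _ _ L.toAddSubgroup
    (inferInstanceAs (DiscreteTopology L))

omit [IsZLattice ℝ L] in
theorem eventually_le_norm (r : ℝ) : ∀ᶠ l : L in cofinite, r ≤ ‖(l : ℂ)‖ := by
  rw [eventually_cofinite]
  refine ((Metric.finite_isBounded_inter_isClosed DiscreteTopology.isDiscrete
    (Metric.isBounded_closedBall (x := (0 : ℂ)) (r := r)) (isClosed_lattice L)).preimage_embedding
    (.subtype _)).subset ?_
  intro t ht
  have ht' : ¬ r ≤ ‖(t : ℂ)‖ := ht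
  simpa using (not_le.1 ht').le

variable {L}

theorem lattice_series {p : ℝ} {F : L → ℂ → ℂ} (hF : ∀ l, Differentiable ℂ (F l))
    (hb : ∀ M σ : ℝ, ∃ C : ℝ, ∀ᶠ l : L in cofinite, ∀ s : ℂ, ‖s‖ ≤ M → σ ≤ s.re →
      ‖F l s‖ ≤ C * ‖(l : ℂ)‖ ^ (-p - σ)) {s : ℂ} (hs : 2 - p < s.re) :
    Summable (fun l => F l s) ∧ DifferentiableAt ℂ (fun s => ∑' l, F l s) s := by
  have hU : IsOpen {s : ℂ | 2 - p < s.re} := isOpen_lt continuous_const Complex.continuous_re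
  have := series_of_eventual_bound hU (fun l => (hF l).differentiableOn) (fun x hx => ?_)
    (show s ∈ {s : ℂ | 2 - p < s.re} from hs)
  · exact ⟨this.1, this.2.1⟩
  have hx' : 2 - p < x.re := hx
  -- The midpoint leaves room on both sides: `p + σ > 2` for summability, and `σ < Re x` for a
  -- neighbourhood of `x`.
  set σ := (2 - p + x.re) / 2 with hσ
  obtain ⟨C, hC⟩ := hb (‖x‖ + 1) σ
  refine ⟨{y | ‖y‖ < ‖x‖ + 1} ∩ {y | σ < y.re}, ?_, fun l => C * ‖(l : ℂ)‖ ^ (-p - σ), ?_, ?_⟩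
  · refine ((isOpen_lt continuous_norm continuous_const).inter
      (isOpen_lt continuous_const Complex.continuous_re)).mem_nhds ⟨?_, ?_⟩
    · show ‖x‖ < ‖x‖ + 1
      linarith
    · show σ < x.re
      linarith
  · have := summable_norm_rpow_neg L (r := p + σ) (by linarith)
    rw [neg_add'] at this
    exact this.mul_left C
  · filter_upwards [hC] with l hl y hy using hl y (le_of_lt hy.1) (le_of_lt hy.2)

theorem eisTerm_series (k : ℕ) {s : ℂ} (hs : 2 - (k : ℝ) < s.re) :
    Summable (fun l : L => eisTerm k s l) ∧
      DifferentiableAt ℂ (fun s => ∑' l : L, eisTerm k s l) s := by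
  refine lattice_series (p := k) (fun l => differentiable_eisTerm k l) (fun M σ => ⟨1, ?_⟩) hs
  filter_upwards [eventually_le_norm L 1] with l hl s _ hσ
  rw [one_mul]
  exact norm_eisTerm_le hl hσ

theorem eisTerm_add_sub_series (k : ℕ) (z : ℂ) {s : ℂ} (hs : 1 - (k : ℝ) < s.re) :
    Summable (fun l : L => eisTerm k s (l + z) - eisTerm k s l) ∧
      DifferentiableAt ℂ (fun s => ∑' l : L, (eisTerm k s (l + z) - eisTerm k s l)) s := by
  refine lattice_series (p := k + 1)
    (fun l => (differentiable_eisTerm k _).fun_sub (differentiable_eisTerm k l))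
    (fun M σ => ⟨7 * max (max M k) 1 * ‖z‖, ?_⟩) (by linarith)
  filter_upwards [eventually_le_norm L 1, eventually_le_norm L (12 * max (max M k) 1 * ‖z‖)]
    with l hl hl' s hM hσ
  have := norm_eisTerm_add_sub_le (k := k) (M := max (max M k) 1) (le_max_right _ _)
    (by linarith [(le_max_right M (k : ℝ)).trans (le_max_left _ (1 : ℝ))])
    (hM.trans ((le_max_left _ _).trans (le_max_left _ _))) hσ le_rfl hl hl'
  rwa [show -((k : ℝ) + 1) - σ = -k - σ - 1 by ring]

theorem differentiable_taylorTerm (k : ℕ) (z l : ℂ) :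
    Differentiable ℂ fun s => taylorTerm k s z l := by
  have h := fun w => differentiable_eisTerm k w
  unfold taylorTerm
  exact (((h _).sub (h _)).add (((differentiable_id.div_const 2).const_add _).mul
    (((h l).div_const l).const_mul z))).add ((differentiable_id.div_const 2).mul
    (((h l).div_const _).const_mul _))

theorem taylorTerm_series (k : ℕ) (z : ℂ) {s : ℂ} (hs : -(k : ℝ) < s.re) :
    Summable (fun l : L => taylorTerm k s z l) ∧
      DifferentiableAt ℂ (fun s => ∑' l : L, taylorTerm k s z l) s := by
  refine lattice_series (p := k + 2) (fun l => differentiable_taylorTerm k z l)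
    (fun M σ => ⟨44 * max (max M k) 1 ^ 2 * ‖z‖ ^ 2, ?_⟩) (by linarith)
  filter_upwards [eventually_le_norm L 1, eventually_le_norm L (12 * max (max M k) 1 * ‖z‖)]
    with l hl hl' s hM hσ
  have := norm_taylorTerm_le (k := k) (M := max (max M k) 1) (le_max_right _ _)
    (by linarith [(le_max_right M (k : ℝ)).trans (le_max_left _ (1 : ℝ))])
    (hM.trans ((le_max_left _ _).trans (le_max_left _ _))) hσ le_rfl hl hl'
  rwa [show -((k : ℝ) + 2) - σ = -k - σ - 2 by ring]

/-! ### Continuation in `s` -/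

/-- `F` continues the Eisenstein series `E_k(z, s)` to `Re s > -1`. -/
def IsEisCont (L : Submodule ℤ ℂ) (k : ℕ) (z : ℂ) (F : ℂ → ℂ) : Prop :=
  DifferentiableOn ℂ F {s : ℂ | -1 < s.re} ∧
    ∀ s : ℂ, 2 - (k : ℝ) < s.re → HasSum (fun l : L => eisTerm k s ((l : ℂ) + z)) (F s)

omit [DiscreteTopology L] [IsZLattice ℝ L] in
theorem IsEisCont.isEisValue {k : ℕ} {z : ℂ} {F : ℂ → ℂ} (h : IsEisCont L k z F) :
    IsEisValue L k z (F 0) := ⟨1, one_pos, F, h.1, h.2, rfl⟩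

omit [DiscreteTopology L] [IsZLattice ℝ L] in
theorem IsEisValue.E_eq {k : ℕ} {z v : ℂ} (h : IsEisValue L k z v) : E L k z = v :=
  IsEisValue.unique (Classical.epsilon_spec ⟨v, h⟩) h

theorem isOpen_re_gt (a : ℝ) : IsOpen {s : ℂ | a < s.re} :=
  isOpen_lt continuous_const Complex.continuous_re

theorem eqOn_re_gt {F G : ℂ → ℂ} {a b : ℝ} (hF : DifferentiableOn ℂ F {s : ℂ | a < s.re})
    (hG : DifferentiableOn ℂ G {s : ℂ | a < s.re}) (h : ∀ s : ℂ, b < s.re → F s = G s)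
    {s : ℂ} (hs : a < s.re) : F s = G s := by
  have h3 : (((max a b + 1 : ℝ) : ℂ)) ∈ {s : ℂ | max a b < s.re} := by
    show max a b < (((max a b + 1 : ℝ) : ℂ)).re
    rw [Complex.ofReal_re]; linarith
  refine (hF.analyticOnNhd (isOpen_re_gt _)).eqOn_of_preconnected_of_eventuallyEq
    (z₀ := ((max a b + 1 : ℝ) : ℂ)) (hG.analyticOnNhd (isOpen_re_gt _))
    (convex_halfSpace_re_gt _).isPreconnected ?_ ?_ hs
  · exact lt_of_le_of_lt (le_max_left a b) h3
  · filter_upwards [(isOpen_re_gt _).mem_nhds h3] with s hs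
    exact h s (lt_of_le_of_lt (le_max_right a b) hs)

/-- If this determinant vanished on all of `L`, real linearity would extend the vanishing to every
`w : ℂ` in the second argument; `w = 1` and `w = i` then force `L = 0`, which does not span. -/
theorem exists_independent (L : Submodule ℤ ℂ) [DiscreteTopology L] [IsZLattice ℝ L] :
    ∃ a ∈ L, ∃ b ∈ L, a * conj b - conj a * b ≠ 0 := by
  by_contra! H
  have key : ∀ a ∈ L, ∀ w : ℂ, a * conj w - conj a * w = 0 := by
    intro a ha w
    have hw : w ∈ Submodule.span ℝ (L : Set ℂ) := by
      rw [IsZLattice.span_top]; trivial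
    induction hw using Submodule.span_induction with
    | mem x hx => exact H a ha x hx
    | zero => simp
    | add x y _ _ hx hy => rw [map_add]; linear_combination hx + hy
    | smul r x _ hx =>
      rw [Complex.real_smul, map_mul, Complex.conj_ofReal]; linear_combination (r : ℂ) * hx
  have hL : ∀ a ∈ L, a = 0 := by
    intro a ha
    have h1 := key a ha 1
    have h2 := key a ha Complex.I
    rw [map_one] at h1
    rw [Complex.conj_I] at h2
    have : (2 * Complex.I) * a = 0 := by linear_combination Complex.I * h1 - h2
    simpa using this
  have h1 : (1 : ℂ) ∈ Submodule.span ℝ (L : Set ℂ) := by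
    rw [IsZLattice.span_top]; trivial
  have : Submodule.span ℝ (L : Set ℂ) = ⊥ := Submodule.span_eq_bot.2 hL
  rw [this] at h1
  simp at h1

theorem summable_eisTerm_add (k : ℕ) (z : ℂ) {s : ℂ} (hs : 2 - (k : ℝ) < s.re) :
    Summable fun l : L => eisTerm k s (l + z) := by
  have h := (eisTerm_add_sub_series (L := L) k z (s := s) (by linarith)).1.add
    (eisTerm_series k hs).1
  simpa using h

omit [DiscreteTopology L] [IsZLattice ℝ L] in
theorem hasSum_add_mem {k : ℕ} {s z a : ℂ} {m : ℂ} (hm : m ∈ L)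
    (h : HasSum (fun l : L => eisTerm k s (l + z)) a) :
    HasSum (fun l : L => eisTerm k s (l + (z + m))) a := by
  have : ((fun l : L => eisTerm k s ((l : ℂ) + z)) ∘ Equiv.addRight (⟨m, hm⟩ : L)) =
      fun l : L => eisTerm k s ((l : ℂ) + (z + m)) := by
    funext l
    simp [add_assoc, add_comm m z]
  rw [← this]
  exact (Equiv.hasSum_iff _).2 h

omit [DiscreteTopology L] [IsZLattice ℝ L] in
theorem hasSum_neg {k : ℕ} {s z a : ℂ}
    (h : HasSum (fun l : L => eisTerm k s (l + z)) a) :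
    HasSum (fun l : L => eisTerm k s (l + -z)) ((-1) ^ k * a) := by
  have h1 := ((Equiv.neg L).hasSum_iff.2 h).mul_left ((-1 : ℂ) ^ k)
  refine h1.congr_fun ?_
  intro l
  simp only [Function.comp_apply, Equiv.neg_apply]
  rw [← eisTerm_neg]
  congr 1
  push_cast
  ring

/-- The symmetry `l ↦ -l` kills the series at `0`, and translation by `m` permutes `L`. -/
theorem tsum_eisTerm_one_add_mem {s m : ℂ} (hs : 1 < s.re) (hm : m ∈ L) :
    HasSum (fun l : L => eisTerm 1 s (l + m)) 0 := by
  have hs' : 2 - ((1 : ℕ) : ℝ) < s.re := by push_cast; linarith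
  have h := (summable_eisTerm_add (L := L) 1 0 hs').hasSum
  have h' := hasSum_neg h
  rw [neg_zero] at h'
  have h0 : (∑' l : L, eisTerm 1 s (l + 0)) = 0 := by
    have := h.unique h'
    rw [pow_one, neg_one_mul] at this
    exact self_eq_neg.1 this
  rw [h0] at h
  simpa using hasSum_add_mem hm h

theorem summable_eisTerm_div_conj {s : ℂ} (hs : 1 < s.re) :
    Summable fun l : L => eisTerm 1 s l / conj (l : ℂ) := by
  have h := (eisTerm_series (L := L) 2 (s := s) (by push_cast; linarith)).1
  refine Summable.of_norm (h.norm.congr fun l => ?_)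
  rw [← eisTerm_one_div, norm_div, norm_div, RCLike.norm_conj]

theorem hasSum_taylor {s : ℂ} (z : ℂ) (hs : 1 < s.re) :
    HasSum (fun l : L => eisTerm 1 s (l + z)) (∑' l : L, taylorTerm 1 s z l -
      z * ((1 + s / 2) * ∑' l : L, eisTerm 2 s l) -
      conj z * (s / 2 * ∑' l : L, eisTerm 1 s l / conj (l : ℂ))) := by
  have h0 : HasSum (fun l : L => eisTerm 1 s l) 0 := by
    simpa using tsum_eisTerm_one_add_mem hs L.zero_mem
  have h1 := (taylorTerm_series (L := L) 1 z (s := s) (by push_cast; linarith)).1.hasSum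
  have h2 := (eisTerm_series (L := L) 2 (s := s) (by push_cast; linarith)).1.hasSum
  have h3 := (summable_eisTerm_div_conj (L := L) hs).hasSum
  have := ((h1.add h0).sub ((h2.mul_left (1 + s / 2)).mul_left z)).sub
    ((h3.mul_left (s / 2)).mul_left (conj z))
  rw [add_zero] at this
  refine this.congr_fun ?_
  intro l
  rw [taylorTerm, eisTerm_one_div]
  push_cast
  ring

/-- At a lattice point `m` the Eisenstein series vanishes, so the Taylor remainder series equals `m
B + m̄ C`. Since the remainder is holomorphic for `Re s > -1`, two independent points continue `B`
and `C` to that half-plane. -/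
theorem exists_coefficients (L : Submodule ℤ ℂ) [DiscreteTopology L] [IsZLattice ℝ L] :
    ∃ B C : ℂ → ℂ, DifferentiableOn ℂ B {s : ℂ | -1 < s.re} ∧
      DifferentiableOn ℂ C {s : ℂ | -1 < s.re} ∧
      ∀ s : ℂ, 1 < s.re → B s = (1 + s / 2) * ∑' l : L, eisTerm 2 s l ∧
        C s = s / 2 * ∑' l : L, eisTerm 1 s l / conj (l : ℂ) := by
  obtain ⟨a, ha, b, hb, hab⟩ := exists_independent L
  let R : ℂ → ℂ → ℂ := fun z s => ∑' l : L, taylorTerm 1 s z l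
  have hR : ∀ z, DifferentiableOn ℂ (R z) {s : ℂ | -1 < s.re} := fun z s hs =>
    (taylorTerm_series (L := L) 1 z (s := s)
      (by push_cast; exact hs)).2.differentiableWithinAt
  have hRm : ∀ m ∈ L, ∀ s : ℂ, 1 < s.re → R m s = m * ((1 + s / 2) * ∑' l : L, eisTerm 2 s l) +
      conj m * (s / 2 * ∑' l : L, eisTerm 1 s l / conj (l : ℂ)) := by
    intro m hm s hs
    have := (hasSum_taylor m hs).unique (tsum_eisTerm_one_add_mem hs hm)
    linear_combination this
  -- Cramer's rule for the equations at `a` and `b`.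
  refine ⟨fun s => (R a s * conj b - R b s * conj a) / (a * conj b - conj a * b),
    fun s => (a * R b s - b * R a s) / (a * conj b - conj a * b), ?_, ?_, fun s hs => ⟨?_, ?_⟩⟩
  · exact (((hR a).mul_const _).sub ((hR b).mul_const _)).div_const _
  · exact (((hR b).const_mul _).sub ((hR a).const_mul _)).div_const _
  · simp only [hRm a ha s hs, hRm b hb s hs]
    rw [div_eq_iff hab]; ring
  · simp only [hRm a ha s hs, hRm b hb s hs]
    rw [div_eq_iff hab]; ring

/-- `∑ ((l + z)⁻¹ - l⁻¹ + z l⁻²)`, the Weierstrass zeta function of `L`. -/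
noncomputable def zetaW (L : Submodule ℤ ℂ) (z : ℂ) : ℂ :=
  ∑' l : L, (((l : ℂ) + z)⁻¹ - (l : ℂ)⁻¹ + z * ((l : ℂ) ^ 2)⁻¹)

/-- `∑ ((l + z)⁻² - l⁻²)`, the Weierstrass `℘` function of `L`, with value `0` on `L`. -/
noncomputable def wp (L : Submodule ℤ ℂ) (z : ℂ) : ℂ :=
  ∑' l : L, ((((l : ℂ) + z) ^ 2)⁻¹ - ((l : ℂ) ^ 2)⁻¹)

theorem exists_isEisCont_one (L : Submodule ℤ ℂ) [DiscreteTopology L] [IsZLattice ℝ L] :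
    ∃ α κ : ℂ, ∀ z : ℂ, ∃ F, IsEisCont L 1 z F ∧ F 0 = zetaW L z - z * α - conj z * κ := by
  obtain ⟨B, C, hB, hC, hBC⟩ := exists_coefficients L
  refine ⟨B 0, C 0, fun z =>
    ⟨fun s => ∑' l : L, taylorTerm 1 s z l - z * B s - conj z * C s, ⟨?_, ?_⟩, ?_⟩⟩
  · have hR : DifferentiableOn ℂ (fun s => ∑' l : L, taylorTerm 1 s z l) {s : ℂ | -1 < s.re} :=
      fun s hs => (taylorTerm_series (L := L) 1 z (s := s)
        (by push_cast; exact hs)).2.differentiableWithinAt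
    exact (hR.sub (hB.const_mul _)).sub (hC.const_mul _)
  · intro s (hs : 2 - ((1 : ℕ) : ℝ) < s.re)
    have hs' : 1 < s.re := by push_cast at hs; linarith
    simp only [(hBC s hs').1, (hBC s hs').2]
    exact hasSum_taylor z hs'
  · show ∑' l : L, taylorTerm 1 0 z l - z * B 0 - conj z * C 0 = _
    rw [zetaW]
    congr 2
    refine tsum_congr fun l => ?_
    simp only [taylorTerm, eisTerm_exponent_zero one_ne_zero]
    push_cast
    ring

/-- The series at `z = 0` is `B s / (1 + s / 2)`, whose denominator has its only zero at `s = -2`;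
the difference from the series at `z` already converges for `Re s > -1`. -/
theorem exists_isEisCont_two (L : Submodule ℤ ℂ) [DiscreteTopology L] [IsZLattice ℝ L] :
    ∃ γ : ℂ, ∀ z : ℂ, ∃ F, IsEisCont L 2 z F ∧ F 0 = wp L z + γ := by
  obtain ⟨B, C, hB, hC, hBC⟩ := exists_coefficients L
  have hne : ∀ s : ℂ, -1 < s.re → 1 + s / 2 ≠ 0 := by
    intro s hs h
    have : s = -2 := by linear_combination 2 * h
    rw [this] at hs
    norm_num at hs
  have hG : DifferentiableOn ℂ (fun s => B s / (1 + s / 2)) {s : ℂ | -1 < s.re} :=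
    hB.div (((differentiable_id.div_const 2).const_add 1).differentiableOn) fun s hs => hne s hs
  -- The coefficients are known only for `Re s > 1`, while the weight 2 series converges for `Re s >
  -- 0`; the identity theorem bridges the gap.
  have hsum : ∀ s : ℂ, 0 < s.re → ∑' l : L, eisTerm 2 s l = B s / (1 + s / 2) := by
    intro s hs
    refine eqOn_re_gt (a := 0) (b := 1) (F := fun s => ∑' l : L, eisTerm 2 s l)
      (G := fun s => B s / (1 + s / 2)) (fun s hs => ?_) (hG.mono fun s hs => ?_) ?_ hs
    · have hs' : (0 : ℝ) < s.re := hs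
      exact (eisTerm_series (L := L) 2 (s := s) (by push_cast; linarith)).2.differentiableWithinAt
    · have hs' : (0 : ℝ) < s.re := hs
      show -1 < s.re
      linarith
    · intro s hs
      rw [eq_div_iff (hne s (by linarith)), (hBC s hs).1]
      ring
  refine ⟨B 0 / (1 + 0 / 2), fun z => ⟨fun s => ∑' l : L, (eisTerm 2 s (l + z) - eisTerm 2 s l) +
    B s / (1 + s / 2), ⟨?_, ?_⟩, ?_⟩⟩
  · refine DifferentiableOn.fun_add (fun s hs => ?_) hG
    have hs' : (-1 : ℝ) < s.re := hs
    exact (eisTerm_add_sub_series (L := L) 2 z (s := s)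
      (by push_cast; linarith)).2.differentiableWithinAt
  · intro s hs
    have hs' : 0 < s.re := by push_cast at hs; linarith
    have h1 := (eisTerm_add_sub_series (L := L) 2 z (s := s) (by push_cast; linarith)).1.hasSum
    have h2 := (eisTerm_series (L := L) 2 hs).1.hasSum
    rw [hsum s hs'] at h2
    simpa using h1.add h2
  · simp only [eisTerm_exponent_zero two_ne_zero, wp]

theorem exists_E_one_eq (L : Submodule ℤ ℂ) [DiscreteTopology L] [IsZLattice ℝ L] :
    ∃ α κ : ℂ, ∀ z : ℂ, E L 1 z = zetaW L z - z * α - conj z * κ := by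
  obtain ⟨α, κ, h⟩ := exists_isEisCont_one L
  refine ⟨α, κ, fun z => ?_⟩
  obtain ⟨F, hF, hF0⟩ := h z
  rw [hF.isEisValue.E_eq, hF0]

theorem E_two_eq (z : ℂ) : E L 2 z = wp L z + E L 2 0 := by
  obtain ⟨γ, h⟩ := exists_isEisCont_two L
  obtain ⟨F, hF, hF0⟩ := h z
  obtain ⟨G, hG, hG0⟩ := h 0
  have : wp L 0 = 0 := by simp [wp]
  rw [hF.isEisValue.E_eq, hG.isEisValue.E_eq, hF0, hG0, this, zero_add]

theorem exists_isEisCont {k : ℕ} (hk : k = 1 ∨ k = 2) (z : ℂ) :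
    ∃ F, IsEisCont L k z F ∧ F 0 = E L k z := by
  have : ∃ F, IsEisCont L k z F := by
    rcases hk with rfl | rfl
    · obtain ⟨α, κ, h⟩ := exists_isEisCont_one L
      exact ⟨_, (h z).choose_spec.1⟩
    · obtain ⟨γ, h⟩ := exists_isEisCont_two L
      exact ⟨_, (h z).choose_spec.1⟩
  exact ⟨_, this.choose_spec, this.choose_spec.isEisValue.E_eq.symm⟩

theorem E_neg {k : ℕ} (hk : k = 1 ∨ k = 2) (z : ℂ) : E L k (-z) = (-1) ^ k * E L k z := by
  obtain ⟨F, hF, hF0⟩ := exists_isEisCont (L := L) hk z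
  have : IsEisCont L k (-z) fun s => (-1) ^ k * F s :=
    ⟨hF.1.const_mul _, fun s hs => hasSum_neg (hF.2 s hs)⟩
  rw [this.isEisValue.E_eq, hF0]

end Lattice

/-! ### The addition theorem -/

section Addition

variable (L : Submodule ℤ ℂ)

/-- The points of `ℂ` that are no nonzero lattice points. -/
def regularAtZero : Set ℂ := ((L : Set ℂ) \ {0})ᶜ

/-- The Weierstrass zeta function without its pole at `0`. -/
noncomputable def zetaW₀ (z : ℂ) : ℂ :=
  ∑' l : L, if l = 0 then 0 else ((l : ℂ) + z)⁻¹ - (l : ℂ)⁻¹ + z * ((l : ℂ) ^ 2)⁻¹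

/-- The Weierstrass `℘` function without its pole at `0`. -/
noncomputable def wp₀ (z : ℂ) : ℂ :=
  ∑' l : L, if l = 0 then 0 else (((l : ℂ) + z) ^ 2)⁻¹ - ((l : ℂ) ^ 2)⁻¹

theorem zetaW₀_zero : zetaW₀ L 0 = 0 := by simp [zetaW₀]

theorem wp₀_zero : wp₀ L 0 = 0 := by simp [wp₀]

variable {L}

theorem zero_mem_regularAtZero : (0 : ℂ) ∈ regularAtZero L := fun h => h.2 rfl

theorem mem_regularAtZero_of_notMem {z : ℂ} (hz : z ∉ L) : z ∈ regularAtZero L := fun h => hz h.1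

theorem add_ne_zero_of_mem_regularAtZero {z : ℂ} (hz : z ∈ regularAtZero L) {l : L} (hl : l ≠ 0) :
    (l : ℂ) + z ≠ 0 := by
  intro h
  have : z = -(l : ℂ) := by linear_combination h
  refine hz ⟨?_, ?_⟩
  · rw [this]; exact L.neg_mem l.2
  · rw [this]
    simpa using hl

variable [DiscreteTopology L] [IsZLattice ℝ L]

omit [IsZLattice ℝ L] in
theorem isOpen_regularAtZero : IsOpen (regularAtZero L) := by
  rw [regularAtZero, isOpen_compl_iff]
  have : (L : Set ℂ) \ {0} = Subtype.val '' {l : L | l ≠ 0} := by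
    ext z
    constructor
    · rintro ⟨h, h0⟩
      exact ⟨⟨z, h⟩, fun h' => h0 (congrArg Subtype.val h'), rfl⟩
    · rintro ⟨l, hl, rfl⟩
      exact ⟨l.2, fun h => hl (Subtype.ext h)⟩
  rw [this]
  exact (isClosed_lattice L).isClosedEmbedding_subtypeVal.isClosedMap _ (isClosed_discrete _)

theorem zetaW₀_series {z : ℂ} (hz : z ∈ regularAtZero L) :
    Summable (fun l : L => if l = 0 then 0 else
      ((l : ℂ) + z)⁻¹ - (l : ℂ)⁻¹ + z * ((l : ℂ) ^ 2)⁻¹) ∧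
    DifferentiableAt ℂ (zetaW₀ L) z ∧
    HasSum (fun l : L => if l = 0 then 0 else (((l : ℂ) + z) ^ 2)⁻¹ - ((l : ℂ) ^ 2)⁻¹)
      (-deriv (zetaW₀ L) z) := by
  have hd : ∀ l : L, l ≠ 0 → ∀ w ∈ regularAtZero L,
      HasDerivAt (fun w => ((l : ℂ) + w)⁻¹ - (l : ℂ)⁻¹ + w * ((l : ℂ) ^ 2)⁻¹)
        (-((((l : ℂ) + w) ^ 2)⁻¹ - ((l : ℂ) ^ 2)⁻¹)) w := by
    intro l hl w hw
    have h1 := ((hasDerivAt_id w).const_add (l : ℂ)).fun_inv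
      (add_ne_zero_of_mem_regularAtZero hw hl)
    have h2 := (hasDerivAt_id w).mul_const ((l : ℂ) ^ 2)⁻¹
    refine ((h1.sub_const (l : ℂ)⁻¹).add h2).congr_deriv ?_
    simp only [id]
    ring
  have key := series_of_eventual_bound (F := fun (l : L) w => if l = 0 then 0 else
      ((l : ℂ) + w)⁻¹ - (l : ℂ)⁻¹ + w * ((l : ℂ) ^ 2)⁻¹) isOpen_regularAtZero ?_ ?_ hz
  · refine ⟨key.1, key.2.1, key.2.2.neg.congr_fun fun l => ?_⟩
    by_cases hl : l = 0
    · simp [hl]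
    · simp only [hl, if_false]
      rw [(hd l hl z hz).deriv, neg_neg]
  · intro l
    by_cases hl : l = 0
    · simp only [hl, if_true]; exact differentiableOn_const _
    · simp only [hl, if_false]
      exact fun w hw => (hd l hl w hw).differentiableAt.differentiableWithinAt
  · intro x _
    refine ⟨Metric.ball x 1, Metric.ball_mem_nhds x one_pos,
      fun l => 44 * (‖x‖ + 1) ^ 2 * ‖(l : ℂ)‖ ^ (-(3 : ℝ)),
      (summable_norm_rpow_neg L (by norm_num)).mul_left _, ?_⟩
    filter_upwards [eventually_le_norm L 1, eventually_le_norm L (12 * (‖x‖ + 1))]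
      with l hl hl' w hw
    have hl0 : l ≠ 0 := by
      rintro rfl
      norm_num at hl
    have hw' : ‖w‖ ≤ ‖x‖ + 1 := by
      have h1 : ‖w - x‖ < 1 := by rwa [← dist_eq_norm]
      calc ‖w‖ = ‖x + (w - x)‖ := by ring_nf
        _ ≤ ‖x‖ + ‖w - x‖ := norm_add_le _ _
        _ ≤ _ := by linarith
    -- At `s = 0` the summand is `taylorTerm 1 0 w l`, of order `‖l‖⁻³`.
    have h := norm_taylorTerm_le (k := 1) (M := 1) (σ := 0) (s := 0) le_rfl (by norm_num)
      (by simp) le_rfl hw' hl (by linarith)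
    simp only [hl0, if_false]
    convert h using 2
    · simp only [taylorTerm, eisTerm_exponent_zero one_ne_zero]
      push_cast
      ring
    · ring
    · norm_num

theorem hasDerivAt_zetaW₀ {z : ℂ} (hz : z ∈ regularAtZero L) :
    HasDerivAt (zetaW₀ L) (-wp₀ L z) z := by
  have h := zetaW₀_series hz
  have : wp₀ L z = -deriv (zetaW₀ L) z := h.2.2.tsum_eq
  rw [this, neg_neg]
  exact h.2.1.hasDerivAt

theorem differentiableAt_wp₀ {z : ℂ} (hz : z ∈ regularAtZero L) :
    DifferentiableAt ℂ (wp₀ L) z := by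
  have h1 : DifferentiableOn ℂ (deriv (zetaW₀ L)) (regularAtZero L) :=
    DifferentiableOn.deriv (fun w hw => (zetaW₀_series hw).2.1.differentiableWithinAt)
      isOpen_regularAtZero
  have h2 := (h1.differentiableAt (isOpen_regularAtZero.mem_nhds hz)).neg
  refine h2.congr_of_eventuallyEq ?_
  filter_upwards [isOpen_regularAtZero.mem_nhds hz] with w hw
  exact (zetaW₀_series hw).2.2.tsum_eq

theorem zetaW_eq {z : ℂ} (hz : z ∈ regularAtZero L) : zetaW L z = z⁻¹ + zetaW₀ L z := by
  classical
  have h1 := (zetaW₀_series hz).1.hasSum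
  have h2 : HasSum (fun l : L => if l = 0 then z⁻¹ else 0) z⁻¹ := hasSum_ite_eq 0 z⁻¹
  rw [zetaW, zetaW₀, ← (h2.add h1).tsum_eq]
  · refine tsum_congr fun l => ?_
    by_cases hl : l = 0 <;> simp [hl]

theorem wp_eq {z : ℂ} (hz : z ∈ regularAtZero L) : wp L z = (z ^ 2)⁻¹ + wp₀ L z := by
  classical
  have h1 := (zetaW₀_series hz).2.2.summable.hasSum
  have h2 : HasSum (fun l : L => if l = 0 then (z ^ 2)⁻¹ else 0) (z ^ 2)⁻¹ := hasSum_ite_eq 0 _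
  rw [wp, wp₀, ← (h2.add h1).tsum_eq]
  · refine tsum_congr fun l => ?_
    by_cases hl : l = 0 <;> simp [hl]

omit [IsZLattice ℝ L] in
theorem eventually_notMem {z : ℂ} (hz : z ∉ L) : ∀ᶠ w in 𝓝 z, w ∉ L :=
  (isClosed_lattice L).isOpen_compl.mem_nhds hz

theorem hasDerivAt_zetaW {z : ℂ} (hz : z ∉ L) : HasDerivAt (zetaW L) (-wp L z) z := by
  have hz0 : z ≠ 0 := fun h => hz (h ▸ L.zero_mem)
  have hr := mem_regularAtZero_of_notMem hz
  have h := (hasDerivAt_inv hz0).add (hasDerivAt_zetaW₀ hr)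
  rw [wp_eq hr, neg_add]
  refine h.congr_of_eventuallyEq ?_
  filter_upwards [eventually_notMem hz] with w hw using
    zetaW_eq (mem_regularAtZero_of_notMem hw)

theorem differentiableAt_wp {z : ℂ} (hz : z ∉ L) : DifferentiableAt ℂ (wp L) z := by
  have hz0 : z ≠ 0 := fun h => hz (h ▸ L.zero_mem)
  have h := ((differentiableAt_id.pow 2).fun_inv (pow_ne_zero 2 hz0)).add
    (differentiableAt_wp₀ (mem_regularAtZero_of_notMem hz))
  refine h.congr_of_eventuallyEq ?_
  filter_upwards [eventually_notMem hz] with w hw using wp_eq (mem_regularAtZero_of_notMem hw)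

/-- Evenness, and likewise periodicity below, is inherited from `E L 2`, which differs from `wp L`
by a constant. -/
theorem wp_neg (z : ℂ) : wp L (-z) = wp L z := by
  have h := E_neg (L := L) (Or.inr rfl : (2 : ℕ) = 1 ∨ 2 = 2) z
  rw [E_two_eq (-z), E_two_eq z] at h
  linear_combination h

theorem wp_add_mem (z : ℂ) {m : ℂ} (hm : m ∈ L) : wp L (z + m) = wp L z := by
  have h := E_add_of_mem L 2 z hm
  rw [E_two_eq (z + m), E_two_eq z] at h
  linear_combination h

/-- The difference of the two sides of the addition theorem. -/
noncomputable def additionDefect (L : Submodule ℤ ℂ) (v u : ℂ) : ℂ :=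
  (E L 1 u + E L 1 v - E L 1 (u + v)) ^ 2 - wp L u - wp L v - wp L (u + v)

/-- The terms `α z + κ z̄` are additive in `z` and cancel. So this combination is both `L`-periodic,
through `E_1`, and meromorphic, through `ζ`. -/
theorem E_one_add_sub (u v : ℂ) :
    E L 1 u + E L 1 v - E L 1 (u + v) = zetaW L u + zetaW L v - zetaW L (u + v) := by
  obtain ⟨α, κ, h⟩ := exists_E_one_eq L
  rw [h, h, h, map_add]
  ring

theorem additionDefect_add_mem (v u : ℂ) {m : ℂ} (hm : m ∈ L) :
    additionDefect L v (u + m) = additionDefect L v u := by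
  rw [additionDefect, additionDefect, add_right_comm, E_add_of_mem L 1 _ hm,
    E_add_of_mem L 1 _ hm, wp_add_mem _ hm, wp_add_mem _ hm]

/-- The reflection swaps `u` with `-(u + v)`, and `E_1` is odd while `℘` is even. It carries the
singularity at `u = -v` to the one at `u = 0`. -/
theorem additionDefect_reflect (v u : ℂ) :
    additionDefect L v (-u - v) = additionDefect L v u := by
  have h1 : -u - v + v = -u := by ring
  have h2 : -u - v = -(u + v) := by ring
  rw [additionDefect, additionDefect, h1, h2, wp_neg, wp_neg, E_neg (Or.inl rfl),
    E_neg (Or.inl rfl)]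
  ring

theorem differentiableAt_additionDefect {u v : ℂ} (hu : u ∉ L) (huv : u + v ∉ L) :
    DifferentiableAt ℂ (additionDefect L v) u := by
  unfold additionDefect
  simp only [E_one_add_sub]
  have h1 := (hasDerivAt_zetaW hu).differentiableAt
  have h2 : DifferentiableAt ℂ (fun u => zetaW L (u + v)) u :=
    DifferentiableAt.comp u (f := fun u => u + v) (hasDerivAt_zetaW huv).differentiableAt
      (differentiableAt_id.add_const v)
  have h3 : DifferentiableAt ℂ (fun u => wp L (u + v)) u :=
    DifferentiableAt.comp u (f := fun u => u + v) (differentiableAt_wp huv)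
      (differentiableAt_id.add_const v)
  exact (((((h1.add_const _).sub h2).pow 2).sub (differentiableAt_wp hu)).sub_const _).sub h3

omit [IsZLattice ℝ L] in
theorem eventually_regular {v : ℂ} (hv : v ∉ L) :
    ∀ᶠ u in 𝓝[≠] (0 : ℂ), u ∉ L ∧ u + v ∉ L := by
  have h1 : ∀ᶠ u in 𝓝 (0 : ℂ), u ∈ regularAtZero L :=
    isOpen_regularAtZero.mem_nhds zero_mem_regularAtZero
  have h2 : ∀ᶠ u in 𝓝 (0 : ℂ), u + v ∉ L := by
    have : Tendsto (fun u : ℂ => u + v) (𝓝 0) (𝓝 v) := by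
      have : Continuous fun u : ℂ => u + v := by fun_prop
      simpa using this.tendsto 0
    exact this.eventually (eventually_notMem hv)
  filter_upwards [h1.filter_mono nhdsWithin_le_nhds, h2.filter_mono nhdsWithin_le_nhds,
    self_mem_nhdsWithin] with u hu1 hu2 hu0
  exact ⟨fun h => hu1 ⟨h, hu0⟩, hu2⟩

/-- Near `u = 0` the squared expression is `(1 / u + r(u))²` with `r(0) = 0` and `r'(0) = ℘(v)`. The
double pole cancels that of `℘(u)`, the middle term `2 r(u) / u` tends to `2 ℘(v)`, and this cancels
`℘(v) + ℘(u + v)`. -/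
theorem tendsto_additionDefect {v : ℂ} (hv : v ∉ L) :
    Tendsto (additionDefect L v) (𝓝[≠] 0) (𝓝 0) := by
  have hshift : HasDerivAt (fun u : ℂ => u + v) 1 0 := (hasDerivAt_id 0).add_const v
  have hz : HasDerivAt (fun u => zetaW L (u + v)) (-wp L v) 0 := by
    have := HasDerivAt.comp (0 : ℂ) (h := fun u => u + v) (h₂ := zetaW L) (h₂' := -wp L v)
      (by rw [zero_add]; exact hasDerivAt_zetaW hv) hshift
    rw [mul_one] at this
    exact this
  set r : ℂ → ℂ := fun u => zetaW₀ L u + zetaW L v - zetaW L (u + v) with hr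
  have hr0 : r 0 = 0 := by simp [hr, zetaW₀_zero]
  have hrd : HasDerivAt r (wp L v) 0 := by
    have := ((hasDerivAt_zetaW₀ (L := L) zero_mem_regularAtZero).add_const (zetaW L v)).sub hz
    rw [wp₀_zero, neg_zero, zero_sub, neg_neg] at this
    exact this
  have hslope := hasDerivAt_iff_tendsto_slope_zero.1 hrd
  simp only [zero_add, hr0, sub_zero, smul_eq_mul] at hslope
  have hle : 𝓝[≠] (0 : ℂ) ≤ 𝓝 0 := nhdsWithin_le_nhds
  have hrt : Tendsto r (𝓝[≠] 0) (𝓝 0) := by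
    have := hrd.continuousAt.tendsto.mono_left hle
    rwa [hr0] at this
  have hp0 : Tendsto (wp₀ L) (𝓝[≠] 0) (𝓝 0) := by
    have := (differentiableAt_wp₀ (L := L) zero_mem_regularAtZero).continuousAt.tendsto.mono_left
      hle
    rwa [wp₀_zero] at this
  have hpv : Tendsto (fun u => wp L (u + v)) (𝓝[≠] 0) (𝓝 (wp L v)) := by
    have h1 : ContinuousAt (wp L) ((0 : ℂ) + v) := by
      rw [zero_add]; exact (differentiableAt_wp hv).continuousAt
    have h2 : ContinuousAt (fun u => wp L (u + v)) 0 :=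
      ContinuousAt.comp (f := fun u => u + v) h1 (by fun_prop)
    have := h2.tendsto.mono_left hle
    simpa using this
  have hlim := ((((hslope.const_mul 2).add (hrt.pow 2)).sub hp0).sub_const (wp L v)).sub hpv
  have e : 2 * wp L v + 0 ^ 2 - 0 - wp L v - wp L v = 0 := by ring
  rw [e] at hlim
  refine hlim.congr' ?_
  filter_upwards [eventually_regular hv, self_mem_nhdsWithin] with u hu hu0
  have hu' := mem_regularAtZero_of_notMem hu.1
  have hu0' : u ≠ 0 := hu0
  rw [additionDefect, E_one_add_sub, zetaW_eq hu', wp_eq hu', hr]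
  field_simp
  ring

open Classical in
/-- The holomorphic continuation of `additionDefect`. -/
noncomputable def additionDefect' (L : Submodule ℤ ℂ) (v u : ℂ) : ℂ :=
  if u ∈ L ∨ u + v ∈ L then 0 else additionDefect L v u

theorem additionDefect'_add_mem (v u : ℂ) {m : ℂ} (hm : m ∈ L) :
    additionDefect' L v (u + m) = additionDefect' L v u := by
  have h1 : u + m ∈ L ↔ u ∈ L := L.add_mem_iff_left hm
  have h2 : u + m + v ∈ L ↔ u + v ∈ L := by rw [add_right_comm]; exact L.add_mem_iff_left hm
  by_cases h : u ∈ L ∨ u + v ∈ L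
  · rw [additionDefect', additionDefect', if_pos h, if_pos (by rwa [h1, h2])]
  · rw [additionDefect', additionDefect', if_neg h, if_neg (by rwa [h1, h2]),
      additionDefect_add_mem v u hm]

theorem additionDefect'_reflect (v u : ℂ) :
    additionDefect' L v (-u - v) = additionDefect' L v u := by
  have h1 : -u - v ∈ L ↔ u + v ∈ L := by rw [← neg_mem_iff]; ring_nf
  have h2 : -u - v + v ∈ L ↔ u ∈ L := by rw [← neg_mem_iff]; ring_nf
  by_cases h : u ∈ L ∨ u + v ∈ L
  · rw [additionDefect', additionDefect', if_pos h, if_pos (by rwa [h1, h2, or_comm])]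
  · rw [additionDefect', additionDefect', if_neg h, if_neg (by rwa [h1, h2, or_comm]),
      additionDefect_reflect]

theorem differentiableAt_additionDefect'_of_regular {u v : ℂ} (hu : u ∉ L) (huv : u + v ∉ L) :
    DifferentiableAt ℂ (additionDefect' L v) u := by
  refine (differentiableAt_additionDefect hu huv).congr_of_eventuallyEq ?_
  have hc : ContinuousAt (fun u : ℂ => u + v) u := by fun_prop
  filter_upwards [eventually_notMem hu, hc.eventually (eventually_notMem huv)] with w h1 h2
  simp [additionDefect', h1, h2]

/-- The singularity at `0` is removable by the limit just computed; periodicity handles all of `L`,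
and the reflection handles `-v + L`. -/
theorem differentiable_additionDefect' {v : ℂ} (hv : v ∉ L) :
    Differentiable ℂ (additionDefect' L v) := by
  have h0 : DifferentiableAt ℂ (additionDefect' L v) 0 := by
    refine (Complex.analyticAt_of_differentiable_on_punctured_nhds_of_continuousAt ?_
      ?_).differentiableAt
    · filter_upwards [eventually_regular hv] with u hu
      exact differentiableAt_additionDefect'_of_regular hu.1 hu.2
    · rw [continuousAt_iff_punctured_nhds]
      have : additionDefect' L v 0 = 0 := by simp [additionDefect']
      rw [this]
      refine (tendsto_additionDefect hv).congr' ?_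
      filter_upwards [eventually_regular hv] with u hu
      simp [additionDefect', hu.1, hu.2]
  have hL : ∀ m ∈ L, DifferentiableAt ℂ (additionDefect' L v) m := by
    intro m hm
    have : additionDefect' L v = fun u => additionDefect' L v (u + -m) := by
      funext u
      exact (additionDefect'_add_mem v u (L.neg_mem hm)).symm
    rw [this]
    exact DifferentiableAt.comp m (f := fun u => u + -m) (by simpa using h0)
      (differentiableAt_id.add_const _)
  intro u
  by_cases hu : u ∈ L
  · exact hL u hu
  by_cases huv : u + v ∈ L
  · have : additionDefect' L v = fun u => additionDefect' L v (-u - v) := by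
      funext u
      exact (additionDefect'_reflect v u).symm
    rw [this]
    refine DifferentiableAt.comp u (f := fun u => -u - v) (hL _ ?_)
      (differentiableAt_id.neg.sub_const _)
    rw [← neg_mem_iff]
    ring_nf
    exact huv
  · exact differentiableAt_additionDefect'_of_regular hu huv

/-- The continued defect is entire and periodic, hence bounded, hence constant by Liouville, and it
is `0` at `0`. -/
theorem E_one_addition {u v : ℂ} (hu : u ∉ L) (hv : v ∉ L) (huv : u + v ∉ L) :
    (E L 1 u + E L 1 v - E L 1 (u + v)) ^ 2 = wp L u + wp L v + wp L (u + v) := by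
  have hd := differentiable_additionDefect' hv
  have hb := (IsZLattice.isCompact_range_of_periodic L _ hd.continuous
    (fun z w hw => additionDefect'_add_mem v z hw)).isBounded
  have h := hd.apply_eq_apply_of_bounded hb u 0
  have h0 : additionDefect' L v 0 = 0 := by simp [additionDefect']
  have hu' : additionDefect' L v u = additionDefect L v u := by simp [additionDefect', hu, huv]
  rw [h0, hu', additionDefect] at h
  linear_combination h

end Addition

/-! ### The index of `k L` in `L` and the distribution relations -/

section Quotient

variable {L : Submodule ℤ ℂ}

theorem coe_ne_zero {k : multiplierRing L} (hk : k ≠ 0) : (k : ℂ) ≠ 0 :=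
  fun h => hk (Subtype.ext h)

theorem mulEnd_injective {k : multiplierRing L} (hk : k ≠ 0) :
    Function.Injective (mulEnd L k) := fun _ _ h =>
  Subtype.ext (mul_left_cancel₀ (coe_ne_zero hk) (congrArg Subtype.val h))

/-- The elements of `L` are uniquely sums of a representative modulo `k L` and an element of
`k L`. -/
theorem bijective_out_add_mul {k : multiplierRing L} (hk : k ≠ 0) :
    Function.Bijective fun x : (L ⧸ scaled L k) × L => x.1.out + mulEnd L k x.2 := by
  have hmk : ∀ x : (L ⧸ scaled L k) × L,
      (Submodule.Quotient.mk (x.1.out + mulEnd L k x.2) : L ⧸ scaled L k) = x.1 := by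
    intro x
    have h0 : (Submodule.Quotient.mk (mulEnd L k x.2) : L ⧸ scaled L k) = 0 :=
      (Submodule.Quotient.mk_eq_zero _).2 (LinearMap.mem_range_self _ _)
    rw [Submodule.Quotient.mk_add, h0, add_zero]
    exact Quotient.out_eq' x.1
  constructor
  · intro x y hxy
    have h1 : x.1 = y.1 := by rw [← hmk x, ← hmk y]; exact congrArg _ hxy
    refine Prod.ext h1 (mulEnd_injective hk ?_)
    have h2 : x.1.out + mulEnd L k x.2 = y.1.out + mulEnd L k y.2 := hxy
    rw [h1] at h2
    exact add_left_cancel h2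
  · intro l
    have h : (Submodule.Quotient.mk l : L ⧸ scaled L k) =
        Submodule.Quotient.mk (Submodule.Quotient.mk (p := scaled L k) l).out :=
      (Quotient.out_eq' _).symm
    obtain ⟨m, hm⟩ := (Submodule.Quotient.eq _).1 h
    refine ⟨((Submodule.Quotient.mk l : L ⧸ scaled L k), m), ?_⟩
    simp only [hm]
    exact add_sub_cancel _ _

variable [DiscreteTopology L] [IsZLattice ℝ L]

/-- The index is the absolute determinant of multiplication by `k` in a `ℤ`-basis of `L`. This is
also a real basis of `ℂ`, where the determinant is `|k|²`. -/
theorem card_quotient_scaled {k : multiplierRing L} (hk : k ≠ 0) :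
    (Nat.card (L ⧸ scaled L k) : ℂ) = k * conj (k : ℂ) := by
  have : Module.Finite ℤ L := ZLattice.module_finite ℝ L
  have : Module.Free ℤ L := ZLattice.module_free ℝ L
  classical
  let b := Module.Free.chooseBasis ℤ L
  have h1 : (LinearMap.det (mulEnd L k)).natAbs = Nat.card (L ⧸ scaled L k) :=
    Submodule.natAbs_det_equiv (scaled L k)
      (LinearEquiv.ofInjective (mulEnd L k) (mulEnd_injective hk))
  have h2 : ((LinearMap.det (mulEnd L k) : ℤ) : ℝ) = Complex.normSq k := by
    rw [← Algebra.norm_complex_apply, Algebra.norm_apply,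
      ← LinearMap.det_toMatrix (b.ofZLatticeBasis ℝ L), ← LinearMap.det_toMatrix b,
      ← eq_intCast (Int.castRingHom ℝ), RingHom.map_det]
    congr 1
    ext i j
    rw [RingHom.mapMatrix_apply, Matrix.map_apply, LinearMap.toMatrix_apply,
      LinearMap.toMatrix_apply, Module.Basis.ofZLatticeBasis_apply]
    have : Algebra.lmul ℝ ℂ (k : ℂ) (b j : ℂ) = ((mulEnd L k (b j) : L) : ℂ) := rfl
    rw [this, Module.Basis.ofZLatticeBasis_repr_apply]
    rfl
  have h3 : ((Nat.card (L ⧸ scaled L k) : ℝ)) = Complex.normSq k := by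
    rw [← h1, Nat.cast_natAbs, Int.cast_abs, h2, abs_of_nonneg (Complex.normSq_nonneg _)]
  rw [Complex.mul_conj, ← h3, Complex.ofReal_natCast]

/-- In the region of convergence, sort `L` by classes modulo `k L` and use the multiplicativity of
`eisTerm`; then continue the identity to `s = 0`. -/
theorem sum_E_distribution {j : ℕ} (hj : j = 1 ∨ j = 2) {k : multiplierRing L} (hk : k ≠ 0)
    [Fintype (L ⧸ scaled L k)] (z : ℂ) :
    ∑ q : L ⧸ scaled L k, E L j ((z + q.out) / k) = (k : ℂ) ^ j * E L j z := by
  have hk' := coe_ne_zero hk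
  obtain ⟨F, hF, hF0⟩ := exists_isEisCont (L := L) hj z
  choose G hG hG0 using fun q : L ⧸ scaled L k =>
    exists_isEisCont (L := L) hj ((z + (q.out : L)) / k)
  have hj0 : j ≠ 0 := by omega
  have key : ∀ s : ℂ, 2 - (j : ℝ) < s.re →
      ∑ q, G q s = eisTerm j s (k : ℂ)⁻¹ * F s := by
    intro s hs
    have h1 := (hF.2 s hs).mul_left (eisTerm j s (k : ℂ)⁻¹)
    have h2 := (Equiv.ofBijective _ (bijective_out_add_mul hk)).hasSum_iff.2 h1
    have h3 := h2.prod_fiberwise (g := fun q => G q s) fun q => by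
      refine ((hG q).2 s hs).congr_fun fun m => ?_
      rw [Function.comp_apply, ← eisTerm_mul _ _ (inv_ne_zero hk')]
      congr 1
      show (k : ℂ)⁻¹ * (((q.out : L) : ℂ) + k * m + z) = _
      field_simp
      ring
    exact (hasSum_fintype _).unique h3
  have h0 := eqOn_re_gt (a := -1) (F := fun s => ∑ q, G q s)
    (G := fun s => eisTerm j s (k : ℂ)⁻¹ * F s)
    (DifferentiableOn.fun_sum fun q _ => (hG q).1)
    ((differentiable_eisTerm j _).differentiableOn.mul hF.1) key (s := 0) (by simp)
  simp only [hG0, hF0, eisTerm_exponent_zero hj0] at h0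
  rw [h0, inv_pow, inv_inv]

end Quotient

/-! ### Functions on the torus `ℂ / L` -/

section Torus

/-- `L` as a module over its ring of multipliers. -/
def latticeModule (L : Submodule ℤ ℂ) : Submodule (multiplierRing L) ℂ where
  carrier := L
  add_mem' := L.add_mem
  zero_mem' := L.zero_mem
  smul_mem' := fun m l hl => m.2 l hl

/-- The torus `ℂ / L`. -/
abbrev Torus (L : Submodule ℤ ℂ) : Type := ℂ ⧸ latticeModule L

variable (L : Submodule ℤ ℂ)

/-- The class of a complex number in the torus. -/
def toTorus : ℂ →ₗ[multiplierRing L] Torus L := (latticeModule L).mkQ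

theorem toTorus_surjective : Function.Surjective (toTorus L) := Submodule.mkQ_surjective _

variable {L}

theorem toTorus_eq_zero {z : ℂ} : toTorus L z = 0 ↔ z ∈ L :=
  Submodule.Quotient.mk_eq_zero (latticeModule L)

theorem toTorus_eq {z w : ℂ} : toTorus L z = toTorus L w ↔ z - w ∈ L := by
  rw [← toTorus_eq_zero, map_sub, sub_eq_zero]

variable (L) in
/-- `E_j` as a function on the torus. -/
noncomputable def torusE (j : ℕ) (t : Torus L) : ℂ := E L j (toTorus_surjective L t).choose

theorem torusE_toTorus (j : ℕ) (z : ℂ) : torusE L j (toTorus L z) = E L j z := by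
  have h := toTorus_eq.1 (toTorus_surjective L (toTorus L z)).choose_spec
  have := E_add_of_mem L j z h
  rwa [add_sub_cancel] at this

variable (L) in
/-- The Weierstrass `℘` function as a function on the torus. -/
noncomputable def torusP (t : Torus L) : ℂ := torusE L 2 t - E L 2 0

open Classical in
/-- The `k`-torsion points of the torus, for `k ≠ 0`. -/
noncomputable def tors (k : multiplierRing L) : Finset (Torus L) :=
  if h : {t : Torus L | k • t = 0}.Finite then h.toFinset else ∅

theorem smul_surjective {k : multiplierRing L} (hk : k ≠ 0) (t : Torus L) :
    ∃ x : Torus L, k • x = t := by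
  obtain ⟨z, rfl⟩ := toTorus_surjective L t
  refine ⟨toTorus L (z / k), ?_⟩
  rw [← map_smul]
  congr 1
  show (k : ℂ) * (z / k) = z
  have := coe_ne_zero hk
  field_simp

theorem torusP_zero : torusP L 0 = 0 := by
  rw [torusP, ← map_zero (toTorus L), torusE_toTorus, sub_self]

variable [DiscreteTopology L] [IsZLattice ℝ L]

theorem torusP_toTorus (z : ℂ) : torusP L (toTorus L z) = wp L z := by
  rw [torusP, torusE_toTorus, E_two_eq]; ring

theorem torusP_neg (t : Torus L) : torusP L (-t) = torusP L t := by
  obtain ⟨z, rfl⟩ := toTorus_surjective L t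
  rw [← map_neg, torusP_toTorus, torusP_toTorus, wp_neg]

theorem torusE_neg (t : Torus L) : torusE L 1 (-t) = -torusE L 1 t := by
  obtain ⟨z, rfl⟩ := toTorus_surjective L t
  rw [← map_neg, torusE_toTorus, torusE_toTorus, E_neg (Or.inl rfl)]
  ring

theorem torusE_zero : torusE L 1 0 = 0 := by
  have h := torusE_neg (L := L) 0
  rw [neg_zero] at h
  exact self_eq_neg.1 h

open Classical in
/-- The addition theorem, with the correction terms for points where a summand has a pole. -/
theorem torus_addition (x y : Torus L) :
    (torusE L 1 x + torusE L 1 y - torusE L 1 (x + y)) ^ 2 =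
      torusP L x + torusP L y + torusP L (x + y) - 2 * ((if x = 0 then torusP L y else 0) +
        (if y = 0 then torusP L x else 0) + (if x + y = 0 then torusP L x else 0)) := by
  -- In each degenerate case the left side is `0` because `E_1` is odd with `E_1(0) = 0`. Since
  -- `℘(0) = 0`, the three `℘`-values amount to twice a single one, which the correction removes; at
  -- `x = y = 0` everything vanishes.
  by_cases hx : x = 0
  · subst hx
    by_cases hy : y = 0
    · subst hy; simp [torusE_zero, torusP_zero]
    · simp [hy, torusE_zero, torusP_zero]; ring
  by_cases hy : y = 0
  · subst hy
    simp [hx, torusE_zero, torusP_zero]; ring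
  by_cases hxy : x + y = 0
  · obtain rfl : y = -x := eq_neg_of_add_eq_zero_right hxy
    simp [hx, torusE_zero, torusP_zero, torusE_neg, torusP_neg]; ring
  simp only [hx, hy, hxy, if_false]
  obtain ⟨u, rfl⟩ := toTorus_surjective L x
  obtain ⟨v, rfl⟩ := toTorus_surjective L y
  rw [← map_add] at hxy ⊢
  rw [toTorus_eq_zero] at hx hy hxy
  simp only [torusE_toTorus, torusP_toTorus]
  rw [E_one_addition hx hy hxy]
  ring

omit [DiscreteTopology L] [IsZLattice ℝ L] in
theorem smul_toTorus_out {k : multiplierRing L} (hk : k ≠ 0) (q : L ⧸ scaled L k) :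
    k • toTorus L (q.out / k) = 0 := by
  rw [← map_smul, toTorus_eq_zero]
  show (k : ℂ) * (((q.out : L) : ℂ) / k) ∈ L
  rw [mul_div_cancel₀ _ (coe_ne_zero hk)]
  exact q.out.2

omit [DiscreteTopology L] [IsZLattice ℝ L] in
theorem bijective_torsion {k : multiplierRing L} (hk : k ≠ 0) :
    Function.Bijective fun q : L ⧸ scaled L k =>
      (⟨toTorus L (q.out / k), smul_toTorus_out hk q⟩ : {t : Torus L | k • t = 0}) := by
  have hk' := coe_ne_zero hk
  constructor
  · intro q r h
    have h1 : toTorus L (q.out / k) = toTorus L (r.out / k) := congrArg Subtype.val h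
    have h2 := toTorus_eq.1 h1
    have h3 : (Submodule.Quotient.mk q.out : L ⧸ scaled L k) = Submodule.Quotient.mk r.out := by
      refine (Submodule.Quotient.eq _).2 ⟨⟨_, h2⟩, Subtype.ext ?_⟩
      show (k : ℂ) * (((q.out : L) : ℂ) / k - ((r.out : L) : ℂ) / k) = (q.out : L) - (r.out : L)
      field_simp
    calc q = Submodule.Quotient.mk q.out := (Quotient.out_eq' q).symm
      _ = Submodule.Quotient.mk r.out := h3
      _ = r := Quotient.out_eq' r
  · rintro ⟨t, ht⟩
    obtain ⟨z, rfl⟩ := toTorus_surjective L t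
    have hz : (k : ℂ) * z ∈ L := by
      have : k • toTorus L z = 0 := ht
      rw [← map_smul, toTorus_eq_zero] at this
      exact this
    refine ⟨Submodule.Quotient.mk ⟨_, hz⟩, Subtype.ext ?_⟩
    have h : (Submodule.Quotient.mk (Submodule.Quotient.mk (p := scaled L k) ⟨_, hz⟩).out :
        L ⧸ scaled L k) = Submodule.Quotient.mk ⟨_, hz⟩ := Quotient.out_eq' _
    obtain ⟨m, hm⟩ := (Submodule.Quotient.eq _).1 h
    have hm' := congrArg Subtype.val hm
    refine toTorus_eq.2 ?_
    have e : (((Submodule.Quotient.mk (p := scaled L k) ⟨_, hz⟩).out : L) : ℂ) / k - z = m := by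
      have : (k : ℂ) * m = ((Submodule.Quotient.mk (p := scaled L k) ⟨_, hz⟩).out : L) - k * z :=
        hm'
      field_simp
      linear_combination -this
    rw [e]
    exact m.2

theorem finite_torsion {k : multiplierRing L} (hk : k ≠ 0) :
    {t : Torus L | k • t = 0}.Finite := by
  have := finite_quotient_scaled L k hk
  exact Set.finite_coe_iff.1 (Finite.of_surjective _ (bijective_torsion hk).2)

theorem mem_tors {k : multiplierRing L} (hk : k ≠ 0) {t : Torus L} : t ∈ tors k ↔ k • t = 0 := by
  rw [tors, dif_pos (finite_torsion hk)]
  simp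

theorem sum_tors {k : multiplierRing L} (hk : k ≠ 0) [Fintype (L ⧸ scaled L k)]
    (f : Torus L → ℂ) : ∑ t ∈ tors k, f t = ∑ q : L ⧸ scaled L k, f (toTorus L (q.out / k)) := by
  have hb := bijective_torsion hk
  refine (Finset.sum_bij (fun q _ => toTorus L (q.out / k)) (fun q _ => ?_) (fun q _ r _ h => ?_)
    (fun t ht => ?_) fun _ _ => rfl).symm
  · exact (mem_tors hk).2 (smul_toTorus_out hk q)
  · exact hb.1 (Subtype.ext h)
  · obtain ⟨q, hq⟩ := hb.2 ⟨t, (mem_tors hk).1 ht⟩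
    exact ⟨q, Finset.mem_univ _, congrArg Subtype.val hq⟩

theorem card_tors {k : multiplierRing L} (hk : k ≠ 0) :
    ((tors k).card : ℂ) = k * conj (k : ℂ) := by
  have := finite_quotient_scaled L k hk
  have := Fintype.ofFinite (L ⧸ scaled L k)
  have h := sum_tors hk fun _ => 1
  rw [Finset.sum_const, Finset.sum_const, Finset.card_univ, nsmul_one, nsmul_one] at h
  rw [h, ← Nat.card_eq_fintype_card, card_quotient_scaled hk]

theorem sum_torusE_one {k : multiplierRing L} (hk : k ≠ 0) (x : Torus L) :
    ∑ t ∈ tors k, torusE L 1 (x + t) = k * torusE L 1 (k • x) := by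
  have := finite_quotient_scaled L k hk
  have := Fintype.ofFinite (L ⧸ scaled L k)
  obtain ⟨z, rfl⟩ := toTorus_surjective L x
  have h := sum_E_distribution (L := L) (j := 1) (Or.inl rfl) hk (k * z)
  have hk' := coe_ne_zero hk
  rw [sum_tors hk, ← map_smul, torusE_toTorus]
  rw [pow_one] at h
  refine Eq.trans (Finset.sum_congr rfl fun q _ => ?_) h
  rw [← map_add, torusE_toTorus]
  congr 1
  field_simp

theorem sum_torusP {k : multiplierRing L} (hk : k ≠ 0) :
    ∑ t ∈ tors k, torusP L t = k * (k - conj (k : ℂ)) * E L 2 0 := by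
  have h1 := card_tors hk
  have := finite_quotient_scaled L k hk
  have := Fintype.ofFinite (L ⧸ scaled L k)
  have h := sum_E_distribution (L := L) (j := 2) (Or.inr rfl) hk 0
  have h2 : ∑ t ∈ tors k, torusE L 2 t = (k : ℂ) ^ 2 * E L 2 0 := by
    rw [sum_tors hk, ← h]
    simp only [torusE_toTorus, zero_add]
  simp only [torusP]
  rw [Finset.sum_sub_distrib, h2, Finset.sum_const, nsmul_eq_mul, h1]
  ring

theorem D_eq_sum_tors (h k : multiplierRing L) (hk : k ≠ 0) :
    D L h k hk = 1 / (k : ℂ) * ∑ t ∈ tors k, torusE L 1 (h • t) * torusE L 1 t := by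
  have := finite_quotient_scaled L k hk
  have := Fintype.ofFinite (L ⧸ scaled L k)
  rw [D, finsum_eq_sum_of_fintype, sum_tors hk]
  congr 1
  refine Finset.sum_congr rfl fun q _ => ?_
  rw [← map_smul, torusE_toTorus, torusE_toTorus]
  conv_lhs => rw [← Quotient.out_eq' q]
  show E L 1 ((h : ℂ) * (q.out : L) / k) * E L 1 (((q.out : L) : ℂ) / k) =
    E L 1 ((h : ℂ) * (((q.out : L) : ℂ) / k)) * _
  rw [mul_div_assoc]

end Torus

/-! ### Sums over torsion points -/

section TorsionSums

variable {L : Submodule ℤ ℂ} [DiscreteTopology L] [IsZLattice ℝ L]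

/-- Multiplication by `n` maps `m n`-torsion onto `m`-torsion, and its fibres are translates of the
`n`-torsion; `r` picks a base point in each. -/
theorem sum_tors_mul {m n : multiplierRing L} (hm : m ≠ 0) (hn : n ≠ 0) {r : Torus L → Torus L}
    (hr : ∀ y, n • r y = y) (f : Torus L → ℂ) :
    ∑ x ∈ tors (m * n), f x = ∑ y ∈ tors m, ∑ t ∈ tors n, f (r y + t) := by
  classical
  have hmn := mul_ne_zero hm hn
  have hmaps : ∀ x ∈ tors (m * n), n • x ∈ tors m := fun x hx => by
    rw [mem_tors hm, smul_smul, ← mem_tors hmn]; exact hx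
  rw [← Finset.sum_fiberwise_of_maps_to hmaps]
  refine Finset.sum_congr rfl fun y hy => ?_
  symm
  refine Finset.sum_bij (fun t _ => r y + t) (fun t ht => ?_) (fun t _ u _ h => ?_)
    (fun x hx => ?_) fun _ _ => rfl
  · rw [mem_tors hn] at ht
    rw [mem_tors hm] at hy
    rw [Finset.mem_filter, mem_tors hmn, mul_smul, smul_add, hr, ht, add_zero]
    exact ⟨hy, rfl⟩
  · exact add_left_cancel h
  · refine ⟨x - r y, ?_, add_sub_cancel _ _⟩
    rw [mem_tors hn, smul_sub, hr, (Finset.mem_filter.1 hx).2, sub_self]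

/-- On the fibre over `y` both `g` and `φ` are constant, so the distribution relation for `E_1`
evaluates the inner sum. -/
theorem sum_tors_mul_torusE {m n : multiplierRing L} (hm : m ≠ 0) (hn : n ≠ 0)
    (φ : Torus L → Torus L) (g : Torus L → ℂ) :
    ∑ x ∈ tors (m * n), torusE L 1 (x + φ (n • x)) * g (n • x) =
      n * ∑ y ∈ tors m, torusE L 1 (y + n • φ y) * g y := by
  choose r hr using fun y : Torus L => smul_surjective hn y
  rw [sum_tors_mul hm hn hr, Finset.mul_sum]
  refine Finset.sum_congr rfl fun y _ => ?_
  have h := sum_torusE_one hn (r y + φ y)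
  rw [smul_add, hr] at h
  rw [← mul_assoc, ← h, Finset.sum_mul]
  refine Finset.sum_congr rfl fun t ht => ?_
  rw [smul_add, hr, (mem_tors hn).1 ht, add_zero, add_right_comm]

theorem sum_tors_mul_smul {m n : multiplierRing L} (hm : m ≠ 0) (hn : n ≠ 0)
    (g : Torus L → ℂ) :
    ∑ x ∈ tors (m * n), g (n • x) = n * conj (n : ℂ) * ∑ y ∈ tors m, g y := by
  choose r hr using fun y : Torus L => smul_surjective hn y
  rw [sum_tors_mul hm hn hr, Finset.mul_sum]
  refine Finset.sum_congr rfl fun y _ => ?_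
  rw [← card_tors hn, ← nsmul_eq_mul, ← Finset.sum_const]
  refine Finset.sum_congr rfl fun t ht => ?_
  rw [smul_add, hr, (mem_tors hn).1 ht, add_zero]

omit [DiscreteTopology L] [IsZLattice ℝ L] in
theorem smul_eq_smul_of_dvd {k a b : multiplierRing L} (h : k ∣ a - b) {t : Torus L}
    (ht : k • t = 0) : a • t = b • t := by
  obtain ⟨r, hr⟩ := h
  rw [← sub_eq_zero, ← sub_smul, hr, mul_comm, mul_smul, ht, smul_zero]

theorem sum_tors_unit_smul {k h h' : multiplierRing L} (hk : k ≠ 0) (hh : k ∣ h * h' - 1)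
    (g : Torus L → ℂ) : ∑ x ∈ tors k, g (h • x) = ∑ x ∈ tors k, g x := by
  have hmem : ∀ a : multiplierRing L, ∀ x ∈ tors k, a • x ∈ tors k := fun a x hx => by
    rw [mem_tors hk] at hx ⊢
    rw [smul_smul, mul_comm, mul_smul, hx, smul_zero]
  refine Finset.sum_bij' (fun x _ => h • x) (fun x _ => h' • x) (hmem h) (hmem h')
    (fun x hx => ?_) (fun x hx => ?_) fun _ _ => rfl
  · rw [smul_smul, mul_comm, smul_eq_smul_of_dvd hh ((mem_tors hk).1 hx), one_smul]
  · rw [smul_smul, smul_eq_smul_of_dvd hh ((mem_tors hk).1 hx), one_smul]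

theorem sum_tors_add {k : multiplierRing L} (hk : k ≠ 0) {x : Torus L} (hx : x ∈ tors k)
    (g : Torus L → ℂ) : ∑ y ∈ tors k, g (x + y) = ∑ y ∈ tors k, g y := by
  rw [mem_tors hk] at hx
  refine Finset.sum_bij' (fun y _ => x + y) (fun y _ => -x + y) (fun y hy => ?_) (fun y hy => ?_)
    (fun y _ => neg_add_cancel_left _ _) (fun y _ => add_neg_cancel_left _ _) fun _ _ => rfl
  · rw [mem_tors hk] at hy ⊢
    rw [smul_add, hx, hy, add_zero]
  · rw [mem_tors hk] at hy ⊢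
    rw [smul_add, smul_neg, hx, hy, neg_zero, add_zero]

theorem sum_tors_torusE {k : multiplierRing L} (hk : k ≠ 0) : ∑ t ∈ tors k, torusE L 1 t = 0 := by
  have h := sum_torusE_one hk 0
  rw [smul_zero, torusE_zero, mul_zero] at h
  simpa using h

/-- Sum the addition theorem over all pairs of torsion points. With `N` points, and `Q`, `P` the
sums of `E_1²` and `℘`, the squares contribute `3 N Q` and all cross terms vanish because `E_1` sums
to `0`. The other side is `3 N P` minus `6 P` from the degenerate pairs. -/
theorem card_mul_sum_torusE_sq {k : multiplierRing L} (hk : k ≠ 0) :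
    ((tors k).card : ℂ) * ∑ t ∈ tors k, torusE L 1 t ^ 2 =
      ((tors k).card - 2 : ℂ) * ∑ t ∈ tors k, torusP L t := by
  classical
  set T := tors k with hT
  set N : ℂ := (T.card : ℂ)
  set e := torusE L 1
  set p := torusP L
  set Q := ∑ t ∈ T, e t ^ 2
  set P := ∑ t ∈ T, p t
  have he : ∑ t ∈ T, e t = 0 := sum_tors_torusE hk
  have h0 : (0 : Torus L) ∈ T := by rw [hT, mem_tors hk, smul_zero]
  have hneg : ∀ x ∈ T, -x ∈ T := fun x hx => by
    rw [hT, mem_tors hk] at hx ⊢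
    rw [smul_neg, hx, neg_zero]
  have hl : ∀ x ∈ T, ∑ y ∈ T, (e x + e y - e (x + y)) ^ 2 =
      N * e x ^ 2 + 2 * Q - 2 * ∑ y ∈ T, e y * e (x + y) := by
    intro x hx
    have h1 : ∑ y ∈ T, e (x + y) = 0 := by rw [sum_tors_add hk hx e, he]
    have h2 : ∑ y ∈ T, e (x + y) ^ 2 = Q := sum_tors_add hk hx fun t => e t ^ 2
    calc _ = ∑ y ∈ T, (e x ^ 2 + e y ^ 2 + e (x + y) ^ 2 + 2 * e x * e y -
          2 * e x * e (x + y) - 2 * (e y * e (x + y))) :=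
          Finset.sum_congr rfl fun y _ => by ring
      _ = _ := by
          simp only [Finset.sum_add_distrib, Finset.sum_sub_distrib, ← Finset.mul_sum, h1, h2, he,
            Finset.sum_const, nsmul_eq_mul]
          ring
  have hcross : ∑ x ∈ T, ∑ y ∈ T, e y * e (x + y) = 0 := by
    rw [Finset.sum_comm]
    refine Finset.sum_eq_zero fun y hy => ?_
    rw [← Finset.mul_sum, Finset.sum_congr rfl fun x _ => by rw [add_comm],
      sum_tors_add hk hy e, he, mul_zero]
  have hr : ∀ x ∈ T, ∑ y ∈ T, (e x + e y - e (x + y)) ^ 2 =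
      N * p x + 2 * P - 2 * ((if x = 0 then P else 0) + p x + p x) := by
    intro x hx
    have h2 : ∑ y ∈ T, p (x + y) = P := sum_tors_add hk hx p
    have h3 : ∑ y ∈ T, (if x = 0 then p y else 0) = if x = 0 then P else 0 := by
      split_ifs <;> simp [P]
    have h4 : ∑ y ∈ T, (if y = 0 then p x else 0) = p x := by
      rw [Finset.sum_ite_eq' T 0, if_pos h0]
    have h5 : ∑ y ∈ T, (if x + y = 0 then p x else 0) = p x := by
      simp only [add_eq_zero_iff_eq_neg', eq_comm]
      rw [Finset.sum_ite_eq' T (-x), if_pos (hneg x hx)]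
    calc _ = ∑ y ∈ T, (p x + p y + p (x + y) - 2 * ((if x = 0 then p y else 0) +
          (if y = 0 then p x else 0) + (if x + y = 0 then p x else 0))) :=
          Finset.sum_congr rfl fun y _ => torus_addition x y
      _ = _ := by
          simp only [Finset.sum_add_distrib, Finset.sum_sub_distrib, ← Finset.mul_sum, h2, h3, h4,
            h5, Finset.sum_const, nsmul_eq_mul]
          ring
  have htot : ∑ x ∈ T, (N * e x ^ 2 + 2 * Q - 2 * ∑ y ∈ T, e y * e (x + y)) =
      ∑ x ∈ T, (N * p x + 2 * P - 2 * ((if x = 0 then P else 0) + p x + p x)) :=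
    Finset.sum_congr rfl fun x hx => (hl x hx).symm.trans (hr x hx)
  have h6 : ∑ x ∈ T, (if x = 0 then P else 0) = P := by
    rw [Finset.sum_ite_eq' T 0, if_pos h0]
  simp only [Finset.sum_add_distrib, Finset.sum_sub_distrib, ← Finset.mul_sum, hcross, h6,
    Finset.sum_const, nsmul_eq_mul] at htot
  change N * Q + 2 * (N * Q) - 2 * 0 = N * P + 2 * (N * P) - 2 * (P + P + P) at htot
  linear_combination htot / 3

theorem sum_torusE_sq_sub {k : multiplierRing L} (hk : k ≠ 0) :
    ∑ t ∈ tors k, torusE L 1 t ^ 2 - ∑ t ∈ tors k, torusP L t =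
      -2 * (k - conj (k : ℂ)) / conj (k : ℂ) * E L 2 0 := by
  have h := card_mul_sum_torusE_sq hk
  have hk' := coe_ne_zero hk
  have hk'' : conj (k : ℂ) ≠ 0 := (map_ne_zero _).2 hk'
  rw [card_tors hk, sum_torusP hk] at h
  rw [sum_torusP hk]
  field_simp
  refine mul_left_cancel₀ hk' ?_
  linear_combination h

/-- Sum the addition theorem with `u = (1 - a n) x`, `v = a n x`, `u + v = x`. The cross terms `u v`
and `x v` cancel after descent to the `c`-torsion. The remaining sums are those of squares and of
`℘`, as `1 - a n` and `a` act invertibly on the `c n`- and the `c`-torsion. -/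
theorem sum_dedekind {c n a a' b : multiplierRing L} (hc : c ≠ 0) (hn : n ≠ 0)
    (ha : c ∣ a * a' - 1) (hb : c * n ∣ (1 - a * n) * b - 1) (han : c ∣ 1 - a * n - a * a) :
    ∑ x ∈ tors (c * n), torusE L 1 ((1 - a * n) • x) * torusE L 1 x =
      (2 * (conj (c * n : ℂ) - c * n) / conj (c * n : ℂ) -
        n * conj (n : ℂ) * (c - conj (c : ℂ)) / conj (c : ℂ) + n * (n - conj (n : ℂ))) *
        E L 2 0 := by
  classical
  have hcn := mul_ne_zero hc hn
  set e := torusE L 1 with he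
  set p := torusP L with hp
  set S := ∑ x ∈ tors (c * n), e ((1 - a * n) • x) * e x with hS
  have hsplit : ∀ x : Torus L, (1 - a * n) • x = x + -(a • n • x) := fun x => by
    rw [sub_smul, one_smul, mul_smul, sub_eq_add_neg]
  have hQ1 := sum_torusE_sq_sub hcn
  have hQ2 := sum_torusE_sq_sub hc
  have hP := sum_torusP hn
  have hcross1 : ∑ x ∈ tors (c * n), e ((1 - a * n) • x) * e (a • n • x) =
      n * ∑ y ∈ tors c, e y * e (a • y) := by
    have h1 := sum_tors_mul_torusE hc hn (fun y => -(a • y)) fun y => e (a • y)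
    simp only [hsplit]
    rw [h1]
    congr 1
    -- Substituting `a y` for `y` produces `E_1(a² y)`, and `a²` acts on `c`-torsion as `1 - a n` by
    -- `han`.
    rw [← sum_tors_unit_smul hc ha fun y => e y * e (a • y)]
    rw [Finset.sum_congr rfl fun y hy => ?_]
    rw [smul_smul, ← smul_eq_smul_of_dvd han ((mem_tors hc).1 hy), sub_smul, one_smul, smul_neg,
      smul_smul, mul_comm n a, ← sub_eq_add_neg, mul_comm]
  have hcross2 : ∑ x ∈ tors (c * n), e x * e (a • n • x) =
      n * ∑ y ∈ tors c, e y * e (a • y) := by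
    have h1 := sum_tors_mul_torusE hc hn (fun _ => 0) fun y => e (a • y)
    simpa using h1
  have hu2 : ∑ x ∈ tors (c * n), e ((1 - a * n) • x) ^ 2 = ∑ x ∈ tors (c * n), e x ^ 2 :=
    sum_tors_unit_smul hcn hb fun x => e x ^ 2
  have hup : ∑ x ∈ tors (c * n), p ((1 - a * n) • x) = ∑ x ∈ tors (c * n), p x :=
    sum_tors_unit_smul hcn hb p
  have hw2 : ∑ x ∈ tors (c * n), e (a • n • x) ^ 2 =
      n * conj (n : ℂ) * ∑ x ∈ tors c, e x ^ 2 := by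
    rw [sum_tors_mul_smul hc hn fun y => e (a • y) ^ 2, sum_tors_unit_smul hc ha fun y => e y ^ 2]
  have hwp : ∑ x ∈ tors (c * n), p (a • n • x) = n * conj (n : ℂ) * ∑ x ∈ tors c, p x := by
    rw [sum_tors_mul_smul hc hn fun y => p (a • y), sum_tors_unit_smul hc ha p]
  have hpn : ∑ x ∈ tors (c * n), (if n • x = 0 then p x else 0) = ∑ x ∈ tors n, p x := by
    rw [← Finset.sum_filter]
    refine Finset.sum_congr ?_ fun _ _ => rfl
    ext x
    rw [Finset.mem_filter, mem_tors hcn, mem_tors hn, mul_smul]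
    exact ⟨fun h => h.2, fun h => ⟨by rw [h, smul_zero], h⟩⟩
  -- Of the three corrections only `v = 0` survives, which means `n x = 0`, and there `u = x`. When
  -- `u = 0` or `u + v = 0`, also `x = 0` and the correction is `℘(0) = 0`.
  have hpt : ∀ x ∈ tors (c * n), (e ((1 - a * n) • x) + e (a • n • x) - e x) ^ 2 =
      p ((1 - a * n) • x) + p (a • n • x) + p x - 2 * (if n • x = 0 then p x else 0) := by
    intro x hx
    have hx' := (mem_tors hcn).1 hx
    have hsum : (1 - a * n) • x + a • n • x = x := by rw [hsplit]; abel
    have h := torus_addition ((1 - a * n) • x) (a • n • x)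
    rw [hsum] at h
    have h1 : (1 - a * n) • x = 0 ↔ x = 0 := by
      refine ⟨fun h => ?_, fun h => by rw [h, smul_zero]⟩
      have := smul_eq_smul_of_dvd hb hx'
      rw [mul_comm, mul_smul, h, smul_zero, one_smul] at this
      exact this.symm
    have h2 : a • n • x = 0 ↔ n • x = 0 := by
      refine ⟨fun h => ?_, fun h => by rw [h, smul_zero]⟩
      have := smul_eq_smul_of_dvd ha (t := n • x) (by rw [smul_smul]; exact hx')
      rw [mul_comm, mul_smul, h, smul_zero, one_smul] at this
      exact this.symm
    have h3 : (if (1 - a * n) • x = 0 then p (a • n • x) else 0) = 0 := by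
      split_ifs with h0
      · rw [h1.1 h0, smul_zero, smul_zero, hp, torusP_zero]
      · rfl
    have h4 : (if x = 0 then p ((1 - a * n) • x) else 0) = 0 := by
      split_ifs with h0
      · rw [h0, smul_zero, hp, torusP_zero]
      · rfl
    have h5 : (if a • n • x = 0 then p ((1 - a * n) • x) else 0) =
        if n • x = 0 then p x else 0 := by
      by_cases h0 : n • x = 0
      · rw [if_pos h0, if_pos (h2.2 h0), hsplit, h2.2 h0, neg_zero, add_zero]
      · rw [if_neg h0, if_neg (h2.not.2 h0)]
    rw [h, h3, h4, h5]
    ring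
  have htot := Finset.sum_congr rfl hpt
  have hexp : ∀ x ∈ tors (c * n), (e ((1 - a * n) • x) + e (a • n • x) - e x) ^ 2 =
      e ((1 - a * n) • x) ^ 2 + e (a • n • x) ^ 2 + e x ^ 2 +
        2 * (e ((1 - a * n) • x) * e (a • n • x)) - 2 * (e ((1 - a * n) • x) * e x) -
        2 * (e x * e (a • n • x)) := fun x _ => by ring
  rw [Finset.sum_congr rfl hexp] at htot
  simp only [Finset.sum_add_distrib, Finset.sum_sub_distrib, ← Finset.mul_sum, hu2, hup, hw2, hwp,
    hpn, hcross1, hcross2] at htot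
  rw [← hS] at htot
  rw [← hp] at hQ1 hQ2 hP
  rw [← he] at hQ1 hQ2
  rw [hP] at htot
  have hmul : ((c * n : multiplierRing L) : ℂ) = c * n := rfl
  rw [hmul] at hQ1
  linear_combination (-1 / 2 : ℂ) * htot + hQ1 + (n * conj (n : ℂ)) / 2 * hQ2

end TorsionSums

end EllipticDedekind

/-! ### From the matrix identity to the torsion sum -/

theorem mainTheorem2 (L : Submodule ℤ ℂ) [DiscreteTopology L] [IsZLattice ℝ L]
    (A₁ A₂ A₃ : Matrix.SpecialLinearGroup (Fin 2) (EllipticDedekind.multiplierRing L))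
    (hA : A₁ = A₂ * A₃)
    (c : EllipticDedekind.multiplierRing L) (hc : c ≠ 0)
    (hc₁ : A₁.1 1 0 = c) (hc₂ : A₂.1 1 0 = c)
    (ha : c ∣ A₁.1 0 0 * A₂.1 0 0 - 1)
    (hc₃ : A₃.1 1 0 ≠ 0) :
    (∀ z : ℂ, EllipticDedekind.IsEisValue L 1 z (EllipticDedekind.E L 1 z)) ∧
    EllipticDedekind.IsEisValue L 2 0 (EllipticDedekind.E L 2 0) ∧
    EllipticDedekind.D L (A₃.1 0 0) (A₃.1 1 0) hc₃ =
      EllipticDedekind.E L 2 0 *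
        EllipticDedekind.I (2 / (A₃.1 1 0 : ℂ) + (A₃.1 1 0 : ℂ) / (c : ℂ) ^ 2) := by
  refine ⟨fun z => ?_, ?_, ?_⟩
  · obtain ⟨F, hF, hF0⟩ := EllipticDedekind.exists_isEisCont (L := L) (Or.inl rfl) z
    exact hF0 ▸ hF.isEisValue
  · obtain ⟨F, hF, hF0⟩ := EllipticDedekind.exists_isEisCont (L := L) (k := 2) (Or.inr rfl) 0
    exact hF0 ▸ hF.isEisValue
  have hentry : ∀ i j, A₁.1 i j = A₂.1 i 0 * A₃.1 0 j + A₂.1 i 1 * A₃.1 1 j := fun i j => by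
    rw [hA, Matrix.SpecialLinearGroup.coe_mul, Matrix.mul_apply, Fin.sum_univ_two]
  have h00 := hentry 0 0
  have h10 := hentry 1 0
  have hdet₂ := Matrix.det_fin_two A₂.1
  have hdet₃ := Matrix.det_fin_two A₃.1
  rw [A₂.2] at hdet₂
  rw [A₃.2] at hdet₃
  rw [hc₂] at h10 hdet₂
  rw [hc₁] at h10
  rw [EllipticDedekind.D_eq_sum_tors]
  generalize A₁.1 0 0 = a₁ at *
  generalize A₂.1 0 0 = a₂ at *
  generalize A₂.1 0 1 = b₂ at *
  generalize A₂.1 1 1 = d₂ at *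
  generalize A₃.1 0 0 = a₃ at *
  generalize A₃.1 0 1 = b₃ at *
  generalize A₃.1 1 0 = c₃ at *
  generalize A₃.1 1 1 = d₃ at *
  obtain ⟨n, hn⟩ : ∃ n, n = a₂ - a₁ := ⟨_, rfl⟩
  -- This is the lower left entry of `A₂⁻¹ A₁`.
  have hc₃n : c₃ = c * n := by
    rw [hn]; linear_combination c₃ * hdet₂ + c * h00 - a₂ * h10
  have ha₃ : a₃ = 1 - d₂ * n := by
    refine mul_left_cancel₀ hc ?_
    linear_combination -h10 - d₂ * hc₃n
  have hn0 : n ≠ 0 := by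
    rintro rfl
    exact hc₃ (by rw [hc₃n, mul_zero])
  subst hc₃n ha₃
  rw [EllipticDedekind.sum_dedekind (a' := a₂) (b := d₃) hc hn0 ⟨b₂, by linear_combination -hdet₂⟩
    ⟨b₃, by linear_combination -hdet₃⟩ ?_]
  · have hc' := EllipticDedekind.coe_ne_zero hc
    have hn' := EllipticDedekind.coe_ne_zero hn0
    have hc'' : (starRingEnd ℂ) (c : ℂ) ≠ 0 := (map_ne_zero _).2 hc'
    have hn'' : (starRingEnd ℂ) (n : ℂ) ≠ 0 := (map_ne_zero _).2 hn'
    have hmul : ((c * n : EllipticDedekind.multiplierRing L) : ℂ) = c * n := rfl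
    -- After division by `c n` the two terms `n̄ / c` cancel, and `n / c` is `c₃ / c²`.
    rw [EllipticDedekind.I, hmul]
    simp only [map_add, map_div₀, map_mul, map_pow, map_ofNat]
    field_simp
    ring
  · obtain ⟨r, hr⟩ := ha
    -- Modulo `c`, both `a₁` and `d₂` are inverse to `a₂`; explicitly `a₁ - d₂ = c (r d₂ - a₁ b₂)`.
    -- With `1 - d₂ a₂ = -b₂ c` this gives the quotient.
    exact ⟨-b₂ + d₂ * (r * d₂ - a₁ * b₂),
      by linear_combination -d₂ * hn + (1 + d₂ * a₁) * hdet₂ + d₂ ^ 2 * hr⟩
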